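/- All Banach spaces are real. Let $\Gamma$ be a group with a finite generating set $S$, acting by homeomorphisms on a compact metric space $(Y,d)$. Assume that the action is free and admits an invariant Borel probability measure. The \emph{infinite cone} $\mathcal O Y$ is the set $(0,\infty)\times Y$ with the metric $d((r,y),(r',y'))=|r-r'|\operatorname{diam}(Y)+\min(r,r')\,d(y,y')$ (only a pseudometric if $Y$ is a point) and the action $\gamma(r,y)=(r,\gamma y)$. The \emph{warped cone} $\mathcal O_\Gamma Y$ is the set $\mathcal O Y$ with the warped metric $d_\Gamma$, the largest (pseudo)metric such that $d_\Gamma\le d$ and $d_\Gamma(x,sx)\le 1$ for all $x\in\mathcal O Y$, $s\in S$. The action is \emph{linearisable} in a Banach space $E$ if there are a linear isometric representation of $\Gamma$ on $E$ and an equivariant bi-Lipschitz embedding $Y\to E$. The group $\Gamma$ is \emph{a-T-menable} (respectively, has property $PL^p$) if it admits an affine isometric action on some Hilbert space (respectively, on some space $L^p(\Omega,\nu)$, where $(\Omega,\nu)$ is a measure space) that is proper, i.e. for every orbit map $\Gamma\to E$ the inverse images of balls are finite. A (pseudo)metric space $X$ admits a \emph{fibred coarse embedding} into a normed space $E$ if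 there exist a field $(E_x)_{x\in X}$ of isometric copies of $E$, sections $f_n\colon X\to\bigsqcup_x E_x$ with $f_n(x)\in E_x$ ($n\in\mathbb N$), and non-decreasing unbounded functions $\rho_\pm\colon[0,\infty)\to[0,\infty)$ such that for every $n$ there are a bounded set $K_n\subseteq X$ and, for all $x\in X\setminus K_n$ and all $y$ in the closed ball $B(x,n)$, surjective isometries $t_n^{x}|_{E_y}\colon E_y\to E$ satisfying: (i) $\rho_-(d(y,y'))\le\|t_n^x f_n(y)-t_n^x f_n(y')\|\le\rho_+(d(y,y'))$ for all $x\in X\setminus K_n$ and $y,y'\in B(x,n)$; (ii) for all $x,x'\in X\setminus K_n$ with $B(x,n)\cap B(x',n)\ne\emptyset$ there is a surjective isometry $t_n^{x,x'}\colon E\to E$ such that $t_n^x|_{E_y}\circ(t_n^{x'}|_{E_y})^{-1}=t_n^{x,x'}$ for all $y\in B(x,n)\cap B(x',n)$. Then: (1) if the action is linearisable in some Hilbert space, then $\mathcal O_\Gamma Y$ admits a fibred coarse embedding into some Hilbert space if and only if $\Gamma$ is a-T-menable; (2) for every $1\le p<\infty$, if the action is linearisable in some $L^p$-space, then $\mathcal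 O_\Gamma Y$ admits a fibred coarse embedding into some $L^p$-space if and only if $\Gamma$ has property $PL^p$. -/

import Mathlib

open Set MeasureTheory
open scoped NNReal ENNReal

universe u v w

namespace WarpedCones

noncomputable section

/-! ### Warped metrics -/

/-- The pseudometrics on `X` that are bounded by the given metric and satisfy `δ (x, s x) ≤ 1` for
all `x : X` and all generators `s ∈ S`. -/
def warpingPseudoMetrics {Γ : Type u} {X : Type v} [SMul Γ X] [PseudoMetricSpace X] (S : Set Γ) :
    Set (PseudoMetric X ℝ) :=
  {δ | (∀ x x', δ x x' ≤ dist x x') ∧ ∀ s ∈ S, ∀ x, δ x (s • x) ≤ 1}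

theorem bddAbove_warping {Γ : Type u} {X : Type v} [SMul Γ X] [PseudoMetricSpace X] (S : Set Γ)
    (x x' : X) :
    BddAbove (range fun δ : warpingPseudoMetrics (X := X) S => (δ : PseudoMetric X ℝ) x x') :=
  ⟨dist x x', by rintro _ ⟨δ, rfl⟩; exact δ.2.1 x x'⟩

theorem bot_mem_warping {Γ : Type u} {X : Type v} [SMul Γ X] [PseudoMetricSpace X] (S : Set Γ) :
    (⊥ : PseudoMetric X ℝ) ∈ warpingPseudoMetrics (X := X) S :=
  ⟨fun x x' => by simp, fun s _ x => by simp⟩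

instance instNonemptyWarping {Γ : Type u} {X : Type v} [SMul Γ X] [PseudoMetricSpace X]
    (S : Set Γ) : Nonempty (warpingPseudoMetrics (X := X) S) :=
  ⟨⟨⊥, bot_mem_warping S⟩⟩

/-- The warped metric: the largest (pseudo)metric `δ` on `X` which is bounded by the given metric
and satisfies `δ (x, s x) ≤ 1` for all `x : X` and `s ∈ S`. -/
def warpedMetric {Γ : Type u} {X : Type v} [SMul Γ X] [PseudoMetricSpace X] (S : Set Γ) :
    PseudoMetric X ℝ where
  toFun x x' := ⨆ δ : warpingPseudoMetrics (X := X) S, (δ : PseudoMetric X ℝ) x x'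
  refl' x := by simp
  symm' x x' := by
    congr 1
    funext δ
    exact (δ : PseudoMetric X ℝ).symm x x'
  triangle' x y z := by
    refine ciSup_le fun δ => ((δ : PseudoMetric X ℝ).triangle x y z).trans ?_
    exact add_le_add (le_ciSup (bddAbove_warping S x y) δ) (le_ciSup (bddAbove_warping S y z) δ)

theorem isGreatest_warpedMetric {Γ : Type u} {X : Type v} [SMul Γ X] [PseudoMetricSpace X]
    (S : Set Γ) : IsGreatest (warpingPseudoMetrics (X := X) S) (warpedMetric S) :=
  ⟨⟨fun x x' => ciSup_le fun δ => δ.2.1 x x', fun s hs x => ciSup_le fun δ => δ.2.2 s hs x⟩,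
    fun δ hδ x x' => le_ciSup (bddAbove_warping S x x') ⟨δ, hδ⟩⟩

/-! ### The infinite cone and the warped cone -/

/-- The infinite cone over `Y`: the set of pairs `(r, y)` with `r > 0` and `y : Y`. -/
@[ext]
structure InfiniteCone (Y : Type v) where
  /-- the radial coordinate -/
  radius : ℝ
  radius_pos : 0 < radius
  /-- the coordinate in the base -/
  point : Y

/-- The action on the base, extended to the cone level by level. -/
instance instMulActionInfiniteCone {Γ : Type u} {Y : Type v} [Group Γ] [MulAction Γ Y] :
    MulAction Γ (InfiniteCone Y) where
  smul g x := ⟨x.radius, x.radius_pos, g • x.point⟩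
  one_smul x := InfiniteCone.ext rfl (one_smul Γ x.point)
  mul_smul g h x := InfiniteCone.ext rfl (mul_smul g h x.point)

/-- The cone metric `d((r, y), (r', y')) = |r - r'| diam(Y) + min(r, r') d(y, y')`. -/
instance instPseudoMetricSpaceInfiniteCone {Y : Type v} [PseudoMetricSpace Y] [CompactSpace Y] :
    PseudoMetricSpace (InfiniteCone Y) where
  dist x x' := |x.radius - x'.radius| * Metric.diam (univ : Set Y) +
    min x.radius x'.radius * dist x.point x'.point
  dist_self x := by simp
  dist_comm x x' := by rw [abs_sub_comm, min_comm, dist_comm]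
  dist_triangle x y z := by
    obtain ⟨r, hr, a⟩ := x
    obtain ⟨s, hs, b⟩ := y
    obtain ⟨t, ht, c⟩ := z
    have hb : ∀ p q : Y, dist p q ≤ Metric.diam (univ : Set Y) := fun p q =>
      Metric.dist_le_diam_of_mem isCompact_univ.isBounded (mem_univ p) (mem_univ q)
    have hD := (dist_nonneg (x := a) (y := b)).trans (hb a b)
    have h1 := hb a c
    have h2 := dist_triangle a b c
    have h3 := dist_nonneg (x := a) (y := b)
    have h4 := dist_nonneg (x := b) (y := c)
    have h5 := dist_nonneg (x := a) (y := c)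
    dsimp only
    generalize Metric.diam (univ : Set Y) = D at *
    generalize dist a b = p at *
    generalize dist b c = q at *
    generalize dist a c = l at *
    rcases le_total (min r t) s with hm | hm
    · have e1 : min r t * l ≤ min r s * p + min s t * q := by
        have k1 : min r t ≤ min r s := le_min (min_le_left _ _) hm
        have k2 : min r t ≤ min s t := le_min hm (min_le_right _ _)
        have k0 : 0 ≤ min r t := (lt_min hr ht).le
        calc min r t * l ≤ min r t * (p + q) := mul_le_mul_of_nonneg_left h2 k0
          _ = min r t * p + min r t * q := by ring
          _ ≤ _ := add_le_add (mul_le_mul_of_nonneg_right k1 h3)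
            (mul_le_mul_of_nonneg_right k2 h4)
      have e2 : |r - t| * D ≤ |r - s| * D + |s - t| * D := by
        rw [← add_mul]
        exact mul_le_mul_of_nonneg_right (abs_sub_le r s t) hD
      linarith
    · have hsr : s ≤ r := hm.trans (min_le_left _ _)
      have hst : s ≤ t := hm.trans (min_le_right _ _)
      rw [min_eq_right hsr, min_eq_left hst, abs_of_nonneg (sub_nonneg.2 hsr),
        abs_of_nonpos (sub_nonpos.2 hst)]
      have e0 : s * l ≤ s * (p + q) := mul_le_mul_of_nonneg_left h2 hs.le
      have e3 : (min r t - s) * l ≤ (min r t - s) * D :=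
        mul_le_mul_of_nonneg_left h1 (sub_nonneg.2 hm)
      have e4 : |r - t| = r + t - 2 * min r t := by
        rcases le_total r t with h | h
        · rw [min_eq_left h, abs_of_nonpos (sub_nonpos.2 h)]; ring
        · rw [min_eq_right h, abs_of_nonneg (sub_nonneg.2 h)]; ring
      have e5 : 0 ≤ (min r t - s) * D := mul_nonneg (sub_nonneg.2 hm) hD
      rw [e4]
      nlinarith

/-- The warped cone of an action of `Γ` on `Y`, for the generating set `S` of `Γ`: the infinite cone
with the warped metric. -/
def WarpedCone {Γ : Type u} (_S : Set Γ) (Y : Type v) : Type v := InfiniteCone Y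

instance instPseudoMetricSpaceWarpedCone {Γ : Type u} {Y : Type v} [Group Γ] [MulAction Γ Y]
    [PseudoMetricSpace Y] [CompactSpace Y] (S : Set Γ) : PseudoMetricSpace (WarpedCone S Y) where
  dist x x' := warpedMetric (X := InfiniteCone Y) S x x'
  dist_self x := (warpedMetric (X := InfiniteCone Y) S).refl x
  dist_comm x x' := (warpedMetric (X := InfiniteCone Y) S).symm x x'
  dist_triangle x x' x'' := (warpedMetric (X := InfiniteCone Y) S).triangle x x' x''

/-! ### Fibred coarse embeddings -/

/-- `X` admits a fibred coarse embedding into the normed space `E`.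

`F` is the field of isometric copies of `E`, `f n` are the sections, and `t x y : F y ≃ᵢ E` is the
restriction to the fibre `F y` of the trivialisation over the ball `B(x, n)`; only its values for
`x ∉ K` and `y ∈ B(x, n)` matter. -/
def FibredCoarselyEmbeds (X : Type v) [PseudoMetricSpace X]
    (E : Type w) [NormedAddCommGroup E] [NormedSpace ℝ E] : Prop :=
  ∃ (F : X → Type w) (_ : ∀ x, NormedAddCommGroup (F x)) (_ : ∀ x, NormedSpace ℝ (F x))
    (_ : ∀ x, Nonempty (F x ≃ₗᵢ[ℝ] E)) (f : ℕ → ∀ x, F x) (ρm ρp : ℝ≥0 → ℝ≥0),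
    Monotone ρm ∧ ¬ BddAbove (range ρm) ∧ Monotone ρp ∧ ¬ BddAbove (range ρp) ∧
    ∀ n : ℕ, ∃ (K : Set X) (t : ∀ _ y : X, F y ≃ᵢ E), Bornology.IsBounded K ∧
      (∀ x ∉ K, ∀ y ∈ Metric.closedBall x n, ∀ y' ∈ Metric.closedBall x n,
        ρm (nndist y y') ≤ nndist (t x y (f n y)) (t x y' (f n y')) ∧
        nndist (t x y (f n y)) (t x y' (f n y')) ≤ ρp (nndist y y')) ∧
      (∀ x ∉ K, ∀ x' ∉ K, (Metric.closedBall x n ∩ Metric.closedBall x' n : Set X).Nonempty →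
        ∃ T : E ≃ᵢ E, ∀ y ∈ (Metric.closedBall x n ∩ Metric.closedBall x' n : Set X), ∀ e : E,
          t x y ((t x' y).symm e) = T e)

/-- `X` admits a fibred coarse embedding into some (real) Hilbert space. -/
def FibredCoarselyEmbedsInHilbert (X : Type v) [PseudoMetricSpace X] : Prop :=
  ∃ (H : Type w) (_ : NormedAddCommGroup H) (_ : InnerProductSpace ℝ H) (_ : CompleteSpace H),
    FibredCoarselyEmbeds X H

/-- `X` admits a fibred coarse embedding into some (real) `L^p`-space. -/
def FibredCoarselyEmbedsInLp (p : ℝ≥0∞) [Fact (1 ≤ p)] (X : Type v) [PseudoMetricSpace X] : Prop :=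
  ∃ (Ω : Type w) (_ : MeasurableSpace Ω) (μ : Measure Ω), FibredCoarselyEmbeds X (Lp ℝ p μ)

/-! ### Proper affine isometric actions -/

/-- `Γ` admits a proper isometric action by affine maps on `E`: for every orbit map, the inverse
images of balls are finite. -/
def HasProperAffineAction (Γ : Type u) [Group Γ] (E : Type w) [NormedAddCommGroup E]
    [NormedSpace ℝ E] : Prop :=
  ∃ α : Γ →* (E ≃ᵃⁱ[ℝ] E), ∀ (e c : E) (R : ℝ), {g : Γ | α g e ∈ Metric.closedBall c R}.Finite

/-- The Haagerup property (a-T-menability). -/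
def ATMenable (Γ : Type u) [Group Γ] : Prop :=
  ∃ (H : Type w) (_ : NormedAddCommGroup H) (_ : InnerProductSpace ℝ H) (_ : CompleteSpace H),
    HasProperAffineAction Γ H

/-- Property `PL^p`. -/
def PropertyPLp (p : ℝ≥0∞) [Fact (1 ≤ p)] (Γ : Type u) [Group Γ] : Prop :=
  ∃ (Ω : Type w) (_ : MeasurableSpace Ω) (μ : Measure Ω), HasProperAffineAction Γ (Lp ℝ p μ)

/-! ### Linearisable actions -/

/-- The action of `Γ` on `Y` is linearisable in `E`: there are an isometric linear representation of
`Γ` on `E` and an equivariant bi-Lipschitz embedding of `Y` into `E`. -/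
def LinearisableIn (Γ : Type u) (Y : Type v) [Group Γ] [MulAction Γ Y] [PseudoMetricSpace Y]
    (E : Type w) [NormedAddCommGroup E] [NormedSpace ℝ E] : Prop :=
  ∃ (π : Γ →* (E ≃ₗᵢ[ℝ] E)) (ι : Y → E), (∀ g y, ι (g • y) = π g (ι y)) ∧
    (∃ C : ℝ≥0, LipschitzWith C ι) ∧ ∃ C : ℝ≥0, AntilipschitzWith C ι

/-- The action is linearisable in some (real) Hilbert space. -/
def LinearisableInHilbert (Γ : Type u) (Y : Type v) [Group Γ] [MulAction Γ Y]
    [PseudoMetricSpace Y] : Prop :=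
  ∃ (H : Type w) (_ : NormedAddCommGroup H) (_ : InnerProductSpace ℝ H) (_ : CompleteSpace H),
    LinearisableIn Γ Y H

/-- The action is linearisable in some (real) `L^p`-space. -/
def LinearisableInLp (p : ℝ≥0∞) [Fact (1 ≤ p)] (Γ : Type u) (Y : Type v) [Group Γ] [MulAction Γ Y]
    [PseudoMetricSpace Y] : Prop :=
  ∃ (Ω : Type w) (_ : MeasurableSpace Ω) (μ : Measure Ω), LinearisableIn Γ Y (Lp ℝ p μ)

end

end WarpedCones

namespace WarpedCones

open Filter Topology

/-! ### Norms and convergence in `L^p` -/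

/-! Suppose first that `Y` has positive diameter. The linearisation `ι` carries the cone into a
normed space by `(r, y) ↦ (r ι(y), r)`. This gives a Γ-invariant distance `coneDist ι`, comparable
with the cone metric on both sides. Up to constants the warped distance from `x` to `x'` is then the
infimum over `g` of `ℓ g + coneDist ι (g • x) x'`, with `ℓ` the word length (`exists_isConeModel`).
By freeness and compactness, far from the apex every nontrivial `g` of bounded length moves every
point far in `coneDist ι`. So for nearby points `x`, `y` the group element carrying `x` close to `y`
is essentially unique.

A proper affine action `α` on `E₁` gives a fibred coarse embedding: let Γ act on the sum of the
linearising space, `E₁` and a line by `π`, `α` and the identity, and use the section `(r, y) ↦ (r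
ι(y), 0, r)`. The fibre over `y` is trivialised from `x` by the inverse of the element moving `x`
close to `y`; uniqueness of that element makes the transition maps constant
(`fibredCoarselyEmbeds_of_isometric_action`).

Conversely, restrict a fibred coarse embedding to a level `{r} × Y` with `r` large. The transition
isometries between base points `y` and `g⁻¹ • y`, recentred at the values of the section, form a
cocycle on a large ball of Γ, with growth controlled by `ρ₋` and `ρ₊`. It twists the shift on
`L^p(Y, L^p(ν))`, isometrically because the measure on `Y` is invariant. An ultralimit over larger
and larger balls is a genuine proper isometric action (`propertyPLp_of_cocycles`), affine by
Mazur–Ulam.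

The ultralimit must again be an `L^p`-space. Rather than invoking an abstract representation of
Banach lattices, a countable family of sequences closed under addition, rational multiples and
absolute values is encoded by its joint distributions, which are measures on a compact box in `ℝ^J`.
Integrals of `|g|^p` for homogeneous `g` survive a projective renormalisation, so a weak limit of
these measures computes all limiting distances. The coordinate functions are dense in its
`L^p`-space by a lattice argument (`exists_Lp_ultralimit`).

The Hilbert case is `p = 2`, since every Hilbert space is an `L^2`-space. -/

theorem toReal_pos_of_one_le {p : ℝ≥0∞} [hp1 : Fact (1 ≤ p)] (hp : p ≠ ∞) : 0 < p.toReal :=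
  ENNReal.toReal_pos (zero_lt_one.trans_le hp1.out).ne' hp

theorem Lp_norm_rpow {Ω : Type*} [MeasurableSpace Ω] {ν : Measure Ω} {p : ℝ≥0∞} [hp1 : Fact (1 ≤ p)]
    (hp : p ≠ ∞) (f : Lp ℝ p ν) : ‖f‖ ^ p.toReal = ∫ ω, |f ω| ^ p.toReal ∂ν := by
  have h0 : p ≠ 0 := (zero_lt_one.trans_le hp1.out).ne'
  have hr := toReal_pos_of_one_le hp
  have hI : 0 ≤ ∫ ω, ‖f ω‖ ^ p.toReal ∂ν := integral_nonneg fun ω => by positivity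
  rw [Lp.norm_def, (Lp.memLp f).eLpNorm_eq_integral_rpow_norm h0 hp,
    ENNReal.toReal_ofReal (by positivity), Real.rpow_inv_rpow hI hr.ne']
  rfl

theorem Lp_norm_rpow_of_ae {Ω : Type*} [MeasurableSpace Ω] {ν : Measure Ω} {p : ℝ≥0∞}
    [hp1 : Fact (1 ≤ p)] (hp : p ≠ ∞) (f : Lp ℝ p ν) {u : Ω → ℝ} (hu : f =ᵐ[ν] u) :
    ‖f‖ ^ p.toReal = ∫ ω, |u ω| ^ p.toReal ∂ν := by
  rw [Lp_norm_rpow hp]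
  exact integral_congr_ae (hu.mono fun ω h => by simp only [h])

/-- Dominated convergence: the measure is finite and the functions are bounded by `1`, so almost
everywhere convergence is convergence in `L^p`. -/
theorem exists_mem_of_tendsto_ae {Ω : Type*} [MeasurableSpace Ω] {ν : Measure Ω} [IsFiniteMeasure ν]
    {p : ℝ≥0∞} [hp1 : Fact (1 ≤ p)] (hp : p ≠ ∞) {V : Set (Lp ℝ p ν)} (hV : IsClosed V)
    {f : ℕ → Lp ℝ p ν} (hf : ∀ k, f k ∈ V) {u : ℕ → Ω → ℝ} (hfu : ∀ k, f k =ᵐ[ν] u k)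
    {v : Ω → ℝ} (hlim : ∀ᵐ ω ∂ν, Tendsto (fun k => u k ω) atTop (𝓝 (v ω)))
    (hb : ∀ k, ∀ᵐ ω ∂ν, |u k ω| ≤ 1) : ∃ g ∈ V, g =ᵐ[ν] v := by
  have hum : ∀ k, AEStronglyMeasurable (u k) ν := fun k =>
    (Lp.aestronglyMeasurable (f k)).congr (hfu k)
  have hvm : AEStronglyMeasurable v ν := aestronglyMeasurable_of_tendsto_ae atTop hum hlim
  have hvb : ∀ᵐ ω ∂ν, |v ω| ≤ 1 := by
    filter_upwards [hlim, ae_all_iff.2 hb] with ω h h'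
    exact le_of_tendsto h.abs (Eventually.of_forall h')
  have hvp : MemLp v p ν := MemLp.of_bound hvm 1 hvb
  refine ⟨hvp.toLp v, ?_, hvp.coeFn_toLp⟩
  refine hV.mem_of_tendsto (f := f) (b := atTop) ?_ (Eventually.of_forall hf)
  have hr := toReal_pos_of_one_le hp
  rw [tendsto_iff_norm_sub_tendsto_zero]
  have key : Tendsto (fun k => ‖f k - hvp.toLp v‖ ^ p.toReal) atTop (𝓝 0) := by
    have e : ∀ k, ‖f k - hvp.toLp v‖ ^ p.toReal = ∫ ω, |u k ω - v ω| ^ p.toReal ∂ν := fun k =>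
      Lp_norm_rpow_of_ae hp _ (by
        filter_upwards [Lp.coeFn_sub (f k) (hvp.toLp v), hfu k, hvp.coeFn_toLp] with ω h1 h2 h3
        rw [h1, Pi.sub_apply, h2, h3])
    simp only [e]
    have : (0 : ℝ) = ∫ ω, (0 : ℝ) ∂ν := by simp
    rw [this]
    refine tendsto_integral_of_dominated_convergence (fun _ => 2 ^ p.toReal) (fun k => ?_)
      (integrable_const _) (fun k => ?_) ?_
    · exact (((hum k).sub hvm).norm.aemeasurable.pow_const _).aestronglyMeasurable
    · filter_upwards [hvb, hb k] with ω h h'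
      rw [Real.norm_of_nonneg (by positivity)]
      refine Real.rpow_le_rpow (abs_nonneg _) ?_ hr.le
      exact (abs_sub _ _).trans (by linarith)
    · filter_upwards [hlim] with ω h
      have h2 : Tendsto (fun k => |u k ω - v ω|) atTop (𝓝 0) := by
        simpa using (h.sub_const (v ω)).abs
      simpa [Real.zero_rpow hr.ne'] using h2.rpow_const (p := p.toReal) (Or.inr hr.le)
  have := key.rpow_const (p := p.toReal⁻¹) (Or.inr (inv_nonneg.2 hr.le))
  simpa [Real.zero_rpow (inv_pos.2 hr).ne', Real.rpow_rpow_inv (norm_nonneg _) hr.ne'] using this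

theorem sup_mem_of_abs_mem {Ω : Type*} [MeasurableSpace Ω] {ν : Measure Ω} {p : ℝ≥0∞}
    [Fact (1 ≤ p)] {V : Submodule ℝ (Lp ℝ p ν)} (habs : ∀ f ∈ V, |f| ∈ V) {f g : Lp ℝ p ν}
    (hf : f ∈ V) (hg : g ∈ V) : f ⊔ g ∈ V := by
  have h : f ⊔ g = (2⁻¹ : ℝ) • (f + g + |g - f|) := by
    ext1
    filter_upwards [Lp.coeFn_sup f g, Lp.coeFn_smul (2⁻¹ : ℝ) (f + g + |g - f|),
      Lp.coeFn_add (f + g) |g - f|, Lp.coeFn_add f g, Lp.coeFn_abs (g - f), Lp.coeFn_sub g f]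
      with ω h1 h2 h3 h4 h5 h6
    rw [h1, h2, Pi.smul_apply, h3, Pi.add_apply, h4, h5, h6, Pi.add_apply, Pi.sup_apply,
      Pi.sub_apply, smul_eq_mul]
    rcases le_total (f ω) (g ω) with h | h
    · rw [sup_eq_right.2 h, abs_of_nonneg (sub_nonneg.2 h)]; ring
    · rw [sup_eq_left.2 h, abs_of_nonpos (sub_nonpos.2 h)]; ring
  rw [h]
  exact V.smul_mem _ (V.add_mem (V.add_mem hf hg) (habs _ (V.sub_mem hg hf)))

/-- A closed vector sublattice of `L^p` over a product space which contains the constants and the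
coordinate functions is everything. -/
theorem closed_sublattice_eq_top {J : Type*} {p : ℝ≥0∞} [Fact (1 ≤ p)] (hp : p ≠ ∞)
    (m : Measure (J → ℝ)) [IsFiniteMeasure m] (V : Submodule ℝ (Lp ℝ p m))
    (hV : IsClosed (V : Set (Lp ℝ p m))) (habs : ∀ f ∈ V, |f| ∈ V)
    (hone : ∃ f ∈ V, f =ᵐ[m] fun _ => (1 : ℝ)) (hcoord : ∀ j, ∃ f ∈ V, f =ᵐ[m] fun z => z j) :
    V = ⊤ := by
  obtain ⟨o, hoV, ho⟩ := hone
  -- The sets whose indicator lies in `V` form a σ-algebra. Once it contains the half-spaces `{z j >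
  -- t}` it contains the whole product σ-algebra, and density of simple functions finishes the
  -- proof.
  let Q : Set (J → ℝ) → Prop := fun A => ∃ f ∈ V, f =ᵐ[m] A.indicator fun _ => (1 : ℝ)
  have hQempty : Q ∅ := ⟨0, V.zero_mem, by simpa using! Lp.coeFn_zero ℝ p m⟩
  have hQcompl : ∀ A, Q A → Q Aᶜ := by
    rintro A ⟨f, hf, hfA⟩
    refine ⟨o - f, V.sub_mem hoV hf, ?_⟩
    filter_upwards [Lp.coeFn_sub o f, ho, hfA] with z h1 h2 h3
    rw [h1, Pi.sub_apply, h2, h3]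
    by_cases hz : z ∈ A <;> simp [hz]
  have hQunion : ∀ A B, Q A → Q B → Q (A ∪ B) := by
    rintro A B ⟨f, hf, hfA⟩ ⟨g, hg, hgB⟩
    refine ⟨f ⊔ g, sup_mem_of_abs_mem habs hf hg, ?_⟩
    filter_upwards [Lp.coeFn_sup f g, hfA, hgB] with z h1 h2 h3
    rw [h1, Pi.sup_apply, h2, h3]
    by_cases hz : z ∈ A <;> by_cases hz' : z ∈ B <;> simp [hz, hz']
  have hQiUnion : ∀ A : ℕ → Set (J → ℝ), (∀ k, Q (A k)) → Q (⋃ k, A k) := by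
    intro A hA
    have hacc : ∀ k, Q (accumulate A k) := by
      intro k
      induction k with
      | zero => simpa using hA 0
      | succ k ih => rw [accumulate_succ]; exact hQunion _ _ ih (hA _)
    choose f hf hfA using hacc
    have := exists_mem_of_tendsto_ae hp hV hf hfA
      (v := (⋃ k, A k).indicator fun _ => (1 : ℝ)) (Eventually.of_forall fun z => ?_) ?_
    · exact this
    · rw [← iUnion_accumulate]
      exact (monotone_accumulate.tendsto_indicator _ _ _).mono_right (pure_le_nhds _)
    · refine fun k => Eventually.of_forall fun z => ?_
      by_cases hz : z ∈ accumulate A k <;> simp [hz]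
  have hQhalf : ∀ (j : J) (t : ℝ), Q ((fun z : J → ℝ => z j) ⁻¹' Ioi t) := by
    intro j t
    obtain ⟨c, hcV, hc⟩ := hcoord j
    -- These are `1 - (1 - k (z j - t)⁺)⁺`, lattice expressions that increase to the indicator of
    -- `{z j > t}`.
    let g : ℕ → Lp ℝ p m := fun k => o - (o - (k : ℝ) • ((c - t • o) ⊔ 0)) ⊔ 0
    have hg : ∀ k, g k ∈ V := fun k => V.sub_mem hoV (sup_mem_of_abs_mem habs (V.sub_mem hoV
      (V.smul_mem _ (sup_mem_of_abs_mem habs (V.sub_mem hcV (V.smul_mem _ hoV)) V.zero_mem)))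
      V.zero_mem)
    refine exists_mem_of_tendsto_ae hp hV hg
      (u := fun k z => 1 - max (1 - k * max (z j - t) 0) 0) (fun k => ?_)
      (Eventually.of_forall fun z => ?_) ?_
    · filter_upwards [Lp.coeFn_sub o ((o - (k : ℝ) • ((c - t • o) ⊔ 0)) ⊔ 0),
        Lp.coeFn_sup (o - (k : ℝ) • ((c - t • o) ⊔ 0)) 0,
        Lp.coeFn_sub o ((k : ℝ) • ((c - t • o) ⊔ 0)), Lp.coeFn_smul (k : ℝ) ((c - t • o) ⊔ 0),
        Lp.coeFn_sup (c - t • o) 0, Lp.coeFn_sub c (t • o), Lp.coeFn_smul t o, ho, hc,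
        Lp.coeFn_zero ℝ p m] with z h1 h2 h3 h4 h5 h6 h7 h8 h9 h10
      simp only [g, h1, Pi.sub_apply, h2, Pi.sup_apply, h3, h4, Pi.smul_apply, h5, h6, h7, h8, h9,
        h10, smul_eq_mul, mul_one, Pi.zero_apply]
    · by_cases hz : t < z j
      · have : z ∈ (fun z : J → ℝ => z j) ⁻¹' Ioi t := hz
        rw [indicator_of_mem this]
        refine tendsto_const_nhds.congr' ?_
        have hpos : 0 < z j - t := sub_pos.2 hz
        obtain ⟨N, hN⟩ := exists_nat_gt (z j - t)⁻¹
        filter_upwards [eventually_ge_atTop N] with k hk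
        rw [max_eq_left hpos.le, max_eq_right, sub_zero]
        have h1 : (z j - t)⁻¹ ≤ k := hN.le.trans (by exact_mod_cast hk)
        rw [sub_nonpos]
        calc (1 : ℝ) = (z j - t)⁻¹ * (z j - t) := (inv_mul_cancel₀ hpos.ne').symm
          _ ≤ _ := by gcongr
      · have : z ∉ (fun z : J → ℝ => z j) ⁻¹' Ioi t := hz
        rw [indicator_of_notMem this]
        have h2 : max (z j - t) 0 = 0 := max_eq_right (by linarith)
        simp [h2]
    · refine fun k => Eventually.of_forall fun z => ?_
      have h1 : 0 ≤ (k : ℝ) * max (z j - t) 0 := by positivity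
      rw [abs_le]
      constructor <;> rcases le_total (1 - k * max (z j - t) 0) 0 with h | h <;>
        simp only [h, max_eq_left, max_eq_right] <;> linarith
  have hQ : ∀ s, MeasurableSet s → Q s := by
    let 𝒜 : MeasurableSpace (J → ℝ) :=
      { MeasurableSet' := Q
        measurableSet_empty := hQempty
        measurableSet_compl := hQcompl
        measurableSet_iUnion := hQiUnion }
    have hle : (MeasurableSpace.pi : MeasurableSpace (J → ℝ)) ≤ 𝒜 :=
      iSup_le fun j => Measurable.comap_le (measurable_of_Ioi (hQhalf j))
    exact hle
  rw [eq_top_iff]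
  rintro f -
  refine Lp.induction hp (fun f => f ∈ V) (fun c s hs hμs => ?_) (fun f g _ _ _ h1 h2 =>
    V.add_mem h1 h2) hV f
  obtain ⟨g, hg, hgs⟩ := hQ s hs
  have : (Lp.simpleFunc.indicatorConst p hs hμs.ne c : Lp ℝ p m) = c • g := by
    rw [Lp.simpleFunc.coe_indicatorConst]
    ext1
    filter_upwards [indicatorConstLp_coeFn (p := p) (hs := hs) (hμs := hμs.ne) (c := c), hgs,
      Lp.coeFn_smul c g] with z h1 h2 h3
    rw [h1, h3, Pi.smul_apply, h2]
    by_cases hz : z ∈ s <;> simp [hz]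
  rw [this]
  exact V.smul_mem _ hg

/-! ### Limits of bounded families in `L^p` -/

theorem exists_finset_exhaustion (J : Type*) [Countable J] :
    ∃ F : ℕ → Finset J, Monotone F ∧ ∀ j, ∃ n, j ∈ F n := by
  obtain ⟨e, he⟩ := exists_injective_nat J
  have hfin : ∀ n, (e ⁻¹' Iio n).Finite := fun n => (finite_Iio n).preimage he.injOn
  refine ⟨fun n => (hfin n).toFinset, fun a b hab => ?_, fun j => ⟨e j + 1, by simp⟩⟩
  exact Finite.toFinset_subset_toFinset.2 (preimage_mono (Iio_subset_Iio hab))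

/-- The change of variables for the projection of a measure to a section of the cone. -/
theorem integral_rpow_map_withDensity {Ω J : Type*} [MeasurableSpace Ω] {ν : Measure Ω} {r : ℝ}
    (hr : 0 < r) {x : Ω → J → ℝ} (hx : Measurable x) {h : Ω → ℝ} (hh : Measurable h)
    (h0 : ∀ ω, 0 ≤ h ω) {g : (J → ℝ) → ℝ} (hg : Measurable g)
    (hom : ∀ c : ℝ, 0 ≤ c → ∀ z, g (c • z) = c * g z) (hz : ∀ᵐ ω ∂ν, h ω = 0 → g (x ω) = 0) :
    ∫ z, |g z| ^ r ∂((ν.withDensity fun ω => ENNReal.ofReal (h ω ^ r)).map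
      fun ω => (h ω)⁻¹ • x ω) = ∫ ω, |g (x ω)| ^ r ∂ν := by
  have hgm : Measurable fun z => |g z| ^ r := (hg.norm.pow_const r : Measurable fun z => ‖g z‖ ^ r)
  have hΦm : Measurable fun ω => (h ω)⁻¹ • x ω :=
    measurable_pi_iff.2 fun j => hh.inv.mul ((measurable_pi_apply j).comp hx)
  rw [integral_map hΦm.aemeasurable hgm.aestronglyMeasurable,
    integral_withDensity_eq_integral_toReal_smul (hh.pow_const r).ennreal_ofReal
      (Eventually.of_forall fun _ => ENNReal.ofReal_lt_top)]
  refine integral_congr_ae (hz.mono fun ω hω => ?_)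
  have hp : 0 ≤ h ω ^ r := Real.rpow_nonneg (h0 ω) r
  simp only [ENNReal.toReal_ofReal hp, smul_eq_mul]
  rcases (h0 ω).eq_or_lt with h | h
  · rw [hω h.symm, ← h, Real.zero_rpow hr.ne', abs_zero, Real.zero_rpow hr.ne', zero_mul]
  · rw [hom _ (inv_nonneg.2 (h0 ω)), abs_mul, abs_of_nonneg (inv_nonneg.2 (h0 ω)),
      Real.mul_rpow (inv_nonneg.2 (h0 ω)) (abs_nonneg _), ← mul_assoc,
      ← Real.mul_rpow (h0 ω) (inv_nonneg.2 (h0 ω)), mul_inv_cancel₀ h.ne', Real.one_rpow, one_mul]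

/-- Positive weights making a given family summable. -/
theorem exists_weights {J : Type*} [Countable J] (B : J → ℝ) :
    ∃ a : J → ℝ, (∀ j, 0 < a j) ∧ ∀ c : J → ℝ, (∀ j, 0 ≤ c j) → (∀ j, c j ≤ |B j|) →
      Summable (fun j => a j * c j) ∧ ∑' j, a j * c j ≤ 1 := by
  obtain ⟨ε, hε, s, hs, hs1⟩ := NNReal.exists_pos_sum_of_countable one_ne_zero J
  refine ⟨fun j => ε j / (1 + |B j|), fun j => div_pos (hε j) (by positivity), fun c hc hcB => ?_⟩
  have hle : ∀ j, (ε j : ℝ) / (1 + |B j|) * c j ≤ ε j := fun j => by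
    rw [div_mul_eq_mul_div, div_le_iff₀ (by positivity)]
    exact mul_le_mul_of_nonneg_left (by linarith [hcB j]) (ε j).2
  have hsR : HasSum (fun j => (ε j : ℝ)) s := NNReal.hasSum_coe.2 hs
  have hsum := Summable.of_nonneg_of_le
    (fun j => mul_nonneg (div_nonneg (ε j).2 (by positivity)) (hc j)) hle hsR.summable
  refine ⟨hsum, (hsum.tsum_le_tsum hle hsR.summable).trans ?_⟩
  rw [hsR.tsum_eq]
  exact_mod_cast hs1.le

/-- The functions `x n j` may live on an infinite measure space and be unbounded, so their joint
distributions need not be tight. Dividing the vector by `h`, an `ℓ^r`-type weighted norm of its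
coordinates, and giving `ν` the density `h ^ r` yields measures of mass at most `1` on a fixed
compact box. This leaves the integrals of `|g| ^ r` unchanged for `g` positively homogeneous of
degree one. Compactness of such measures supplies `m`. -/
theorem exists_limit_measure {J Ω : Type*} [Countable J] [MeasurableSpace Ω] (ν : Measure Ω)
    (𝒰 : Ultrafilter ℕ) (h𝒰 : (𝒰 : Filter ℕ) ≤ atTop) {r : ℝ} (hr : 0 < r) (x : ℕ → J → Ω → ℝ)
    (hx : ∀ n j, Measurable (x n j)) (hInt : ∀ n j, Integrable (fun ω => |x n j ω| ^ r) ν)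
    (hb : ∀ j, ∃ B, ∀ᶠ n in 𝒰, ∫ ω, |x n j ω| ^ r ∂ν ≤ B) :
    ∃ (b : J → ℝ) (m : Measure (J → ℝ)), IsFiniteMeasure m ∧ (∀ᵐ z ∂m, ∀ j, |z j| ≤ b j) ∧
      ∀ (s : Finset J) (g : (J → ℝ) → ℝ), Continuous g →
        (∀ c : ℝ, 0 ≤ c → ∀ z, g (c • z) = c * g z) →
        (∀ z z' : J → ℝ, (∀ j ∈ s, z j = z' j) → g z = g z') →
        Tendsto (fun n => ∫ ω, |g (fun j => x n j ω)| ^ r ∂ν) 𝒰 (𝓝 (∫ z, |g z| ^ r ∂m)) := by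
  classical
  choose B hB using hb
  obtain ⟨F, hFmono, hF⟩ := exists_finset_exhaustion J
  obtain ⟨a, ha, hasum⟩ := exists_weights B
  -- Only finitely many coordinates are kept at stage `n`, and only those already obeying their
  -- bound. Each coordinate is kept for `𝒰`-almost every `n`, so a function of finitely many
  -- coordinates does not see the truncation in the limit.
  let Y : ℕ → Ω → J → ℝ := fun n ω j =>
    if j ∈ F n ∧ ∫ ω, |x n j ω| ^ r ∂ν ≤ B j then x n j ω else 0
  have hYm : ∀ n, Measurable (Y n) := fun n => measurable_pi_iff.2 fun j => by
    by_cases h : j ∈ F n ∧ ∫ ω, |x n j ω| ^ r ∂ν ≤ B j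
    · simpa only [Y, if_pos h] using hx n j
    · simp only [Y, if_neg h]; exact measurable_const
  have hYint : ∀ n j, Integrable (fun ω => |Y n ω j| ^ r) ν ∧
      ∫ ω, |Y n ω j| ^ r ∂ν ≤ |B j| := fun n j => by
    by_cases h : j ∈ F n ∧ ∫ ω, |x n j ω| ^ r ∂ν ≤ B j
    · simp only [Y, if_pos h]; exact ⟨hInt n j, h.2.trans (le_abs_self _)⟩
    · simp [Y, if_neg h, Real.zero_rpow hr.ne']
  let H : ℕ → Ω → ℝ := fun n ω => ∑ j ∈ F n, a j * |Y n ω j| ^ r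
  have hH0 : ∀ n ω, 0 ≤ H n ω := fun n ω => Finset.sum_nonneg fun j _ =>
    mul_nonneg (ha j).le (by positivity)
  have hYH : ∀ n ω j, a j * |Y n ω j| ^ r ≤ H n ω := fun n ω j => by
    by_cases hj : j ∈ F n
    · exact Finset.single_le_sum (f := fun j => a j * |Y n ω j| ^ r)
        (fun j _ => mul_nonneg (ha j).le (by positivity)) hj
    · have : Y n ω j = 0 := if_neg fun h => hj h.1
      rw [this, abs_zero, Real.zero_rpow hr.ne', mul_zero]
      exact hH0 n ω
  let h : ℕ → Ω → ℝ := fun n ω => H n ω ^ r⁻¹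
  have hh0 : ∀ n ω, 0 ≤ h n ω := fun n ω => Real.rpow_nonneg (hH0 n ω) _
  have hhr : ∀ n ω, h n ω ^ r = H n ω := fun n ω => Real.rpow_inv_rpow (hH0 n ω) hr.ne'
  have hHint : ∀ n, Integrable (H n) ν := fun n =>
    integrable_finsetSum _ fun j _ => (hYint n j).1.const_mul (a j)
  have hHle : ∀ n, ∫ ω, H n ω ∂ν ≤ 1 := fun n => by
    have hc0 : ∀ j, 0 ≤ ∫ ω, |Y n ω j| ^ r ∂ν := fun j =>
      integral_nonneg fun ω => by positivity
    obtain ⟨hs, hs1⟩ := hasum (fun j => ∫ ω, |Y n ω j| ^ r ∂ν) hc0 fun j => (hYint n j).2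
    rw [integral_finsetSum _ fun j _ => (hYint n j).1.const_mul (a j)]
    simp only [integral_const_mul]
    exact (hs.sum_le_tsum _ fun j _ => mul_nonneg (ha j).le (hc0 j)).trans hs1
  have hHm : ∀ n, Measurable (H n) := fun n => Finset.measurable_sum _ fun j _ =>
    ((((measurable_pi_apply j).comp (hYm n)).norm.pow_const r :
      Measurable fun ω => ‖Y n ω j‖ ^ r)).const_mul (a j)
  have hhm : ∀ n, Measurable (h n) := fun n => (hHm n).pow_const _
  let Φ : ℕ → Ω → J → ℝ := fun n ω => (h n ω)⁻¹ • Y n ω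
  have hΦm : ∀ n, Measurable (Φ n) := fun n => (hhm n).inv.smul (hYm n)
  let D : ℕ → Measure Ω := fun n => ν.withDensity fun ω => ENNReal.ofReal (h n ω ^ r)
  have hDle : ∀ n, D n univ ≤ 1 := fun n => by
    simp only [D, hhr]
    rw [withDensity_apply _ MeasurableSet.univ, Measure.restrict_univ,
      ← ofReal_integral_eq_lintegral_ofReal (hHint n) (Eventually.of_forall (hH0 n))]
    exact ENNReal.ofReal_le_one.2 (hHle n)
  -- From `a j * |Y n ω j| ^ r ≤ h n ω ^ r`.
  let b : J → ℝ := fun j => ((a j)⁻¹) ^ r⁻¹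
  have hΦb : ∀ n ω j, |Φ n ω j| ≤ b j := fun n ω j => by
    simp only [Φ, Pi.smul_apply, smul_eq_mul, abs_mul, abs_inv, abs_of_nonneg (hh0 n ω)]
    have hY : |Y n ω j| ≤ b j * h n ω := by
      have h1 : |Y n ω j| ^ r ≤ (a j)⁻¹ * H n ω := by
        rw [inv_mul_eq_div, le_div_iff₀ (ha j), mul_comm]; exact hYH n ω j
      have h2 := Real.rpow_le_rpow (by positivity) h1 (inv_nonneg.2 hr.le)
      rwa [Real.rpow_rpow_inv (abs_nonneg _) hr.ne',
        Real.mul_rpow (inv_nonneg.2 (ha j).le) (hH0 n ω)] at h2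
    rcases (hh0 n ω).eq_or_lt with h' | h'
    · rw [← h', inv_zero, zero_mul]
      exact Real.rpow_nonneg (inv_nonneg.2 (ha j).le) _
    · rw [inv_mul_le_iff₀ h', mul_comm]; exact hY
  let K : Set (J → ℝ) := Set.pi univ fun j => Icc (-b j) (b j)
  have hK : IsCompact K := isCompact_univ_pi fun j => isCompact_Icc
  have hmemK : ∀ z : J → ℝ, z ∈ K ↔ ∀ j, |z j| ≤ b j := fun z => by
    simp only [K, mem_univ_pi, mem_Icc, abs_le]
  have hfinD : ∀ n, IsFiniteMeasure (D n) := fun n => ⟨(hDle n).trans_lt ENNReal.one_lt_top⟩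
  let μ : ℕ → FiniteMeasure (J → ℝ) := fun n => ⟨(D n).map (Φ n), inferInstance⟩
  have hμmass : ∀ n, (μ n).mass ≤ 1 := fun n => by
    have : ((μ n).mass : ℝ≥0∞) ≤ 1 := by
      rw [FiniteMeasure.ennreal_mass]
      change (D n).map (Φ n) univ ≤ 1
      rw [Measure.map_apply (hΦm n) MeasurableSet.univ]
      exact hDle n
    exact_mod_cast this
  have hμKm : ∀ n, ((μ n : Measure (J → ℝ))) Kᶜ = 0 := fun n => by
    change (D n).map (Φ n) Kᶜ = 0
    rw [Measure.map_apply (hΦm n) hK.measurableSet.compl]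
    have : Φ n ⁻¹' Kᶜ = ∅ := by
      ext ω; simp only [mem_preimage, mem_compl_iff, mem_empty_iff_false, iff_false, not_not]
      exact (hmemK _).2 (hΦb n ω)
    rw [this, measure_empty]
  have hcomp := isCompact_setOfPred_finiteMeasure_le_of_isCompact (E := J → ℝ) 1 hK
  obtain ⟨m, ⟨-, hmK⟩, hm⟩ := hcomp.ultrafilter_le_nhds' (𝒰.map μ) (by
    rw [Ultrafilter.mem_map]
    refine univ_mem' fun n => ⟨hμmass n, ?_⟩
    have := hμKm n
    exact (FiniteMeasure.null_iff_toMeasure_null _ _).2 this)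
  have hmK' : (m : Measure (J → ℝ)) Kᶜ = 0 := (FiniteMeasure.null_iff_toMeasure_null _ _).1 hmK
  have hlim : Tendsto μ 𝒰 (𝓝 m) := hm
  rw [FiniteMeasure.tendsto_iff_forall_integral_tendsto] at hlim
  refine ⟨b, m, inferInstance, ?_, fun s g hgc hom hdep => ?_⟩
  · have : ∀ᵐ z ∂(m : Measure (J → ℝ)), z ∈ K := hmK'
    exact this.mono fun z hz => (hmemK z).1 hz
  -- Clamping to the box turns `|g| ^ r` into a bounded continuous test function, without changing
  -- it where the measures live.
  let cl : (J → ℝ) → J → ℝ := fun z j => max (-b j) (min (b j) (z j))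
  have hb0 : ∀ j, 0 ≤ b j := fun j => Real.rpow_nonneg (inv_nonneg.2 (ha j).le) _
  have hcl : ∀ z, cl z ∈ K := fun z => (hmemK _).2 fun j => abs_le.2
    ⟨le_max_left _ _, max_le (by linarith [hb0 j]) (min_le_left _ _)⟩
  have hclid : ∀ z ∈ K, cl z = z := fun z hz => by
    funext j
    have := abs_le.1 ((hmemK z).1 hz j)
    simp only [cl, min_eq_right this.2, max_eq_right this.1]
  have hclc : Continuous cl := continuous_pi fun j =>
    continuous_const.max (continuous_const.min (continuous_apply j))
  have hGc : Continuous fun z => |g (cl z)| ^ r :=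
    (hgc.comp hclc).abs.rpow_const fun _ => Or.inr hr.le
  obtain ⟨C, hC⟩ := hK.exists_bound_of_continuousOn
    (f := fun z => |g z| ^ r) (hgc.abs.rpow_const fun _ => Or.inr hr.le).continuousOn
  let G : BoundedContinuousFunction (J → ℝ) ℝ :=
    BoundedContinuousFunction.ofNormedAddCommGroup (fun z => |g (cl z)| ^ r) hGc C
      fun z => hC _ (hcl z)
  have hGint : ∀ μ' : Measure (J → ℝ), μ' Kᶜ = 0 → ∫ z, G z ∂μ' = ∫ z, |g z| ^ r ∂μ' :=
    fun μ' hμ' => integral_congr_ae (by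
      have : ∀ᵐ z ∂μ', z ∈ K := hμ'
      exact this.mono fun z hz => by
        simp only [G, BoundedContinuousFunction.coe_ofNormedAddCommGroup, hclid z hz])
  have hlim' := hlim G
  rw [hGint _ hmK'] at hlim'
  refine hlim'.congr' ?_
  have hev : ∀ᶠ n in (𝒰 : Filter ℕ), ∀ j ∈ s, j ∈ F n ∧ ∫ ω, |x n j ω| ^ r ∂ν ≤ B j := by
    rw [Filter.eventually_all_finset]
    intro j _
    obtain ⟨N, hN⟩ := hF j
    exact (((eventually_ge_atTop N).filter_mono h𝒰).mono fun n hn => hFmono hn hN).and (hB j)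
  filter_upwards [hev] with n hn
  rw [hGint _ (hμKm n)]
  change ∫ z, |g z| ^ r ∂((D n).map (Φ n)) = _
  rw [integral_rpow_map_withDensity hr (hYm n) (hhm n) (hh0 n) hgc.measurable hom]
  · refine integral_congr_ae (Eventually.of_forall fun ω => ?_)
    have : g (Y n ω) = g fun j => x n j ω := hdep _ _ fun j hj => if_pos (hn j hj)
    simp only [this]
  · refine Eventually.of_forall fun ω hω => ?_
    have hH : H n ω = 0 := by rw [← hhr n ω, hω, Real.zero_rpow hr.ne']
    have hY : Y n ω = (0 : ℝ) • Y n ω := by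
      rw [zero_smul]
      funext j
      have h1 := hYH n ω j
      rw [hH] at h1
      by_contra hne
      have : 0 < |Y n ω j| ^ r := Real.rpow_pos_of_pos (abs_pos.2 hne) r
      exact absurd h1 (not_le.2 (mul_pos (ha j) this))
    rw [hY, hom 0 le_rfl, zero_mul]

/-- A finite measure on a box can be projected to a section of the cone on which a weighted sum of
the absolute values of the coordinates is `1`. -/
theorem exists_normalized_measure {J : Type*} [Countable J] {r : ℝ} (hr : 0 < r)
    (m : Measure (J → ℝ)) [IsFiniteMeasure m] {b : J → ℝ} (hb : ∀ᵐ z ∂m, ∀ j, |z j| ≤ b j) :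
    ∃ (a : J → ℝ) (m' : Measure (J → ℝ)), IsFiniteMeasure m' ∧ (∀ j, 0 < a j) ∧
      (∀ᵐ z ∂m', HasSum (fun j => a j * |z j|) 1) ∧
      ∀ g : (J → ℝ) → ℝ, Measurable g → (∀ c : ℝ, 0 ≤ c → ∀ z, g (c • z) = c * g z) →
        ∫ z, |g z| ^ r ∂m' = ∫ z, |g z| ^ r ∂m := by
  -- An infinite weighted sum of coordinates is not continuous on the box, so a normalisation made
  -- before the limit need not persist. This one is made after it, with a sum linear in `|z j|`, so
  -- that the constant `1` becomes a limit of lattice combinations of the coordinates.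
  obtain ⟨a, ha, hasum⟩ := exists_weights b
  let T : (J → ℝ) → ℝ≥0∞ := fun z => ∑' j, ENNReal.ofReal (a j * |z j|)
  have hTm : Measurable T := Measurable.tsum fun j => by fun_prop
  let h : (J → ℝ) → ℝ := fun z => (T z).toReal
  have hhm : Measurable h := hTm.ennreal_toReal
  have hh0 : ∀ z, 0 ≤ h z := fun z => ENNReal.toReal_nonneg
  have hnn : ∀ (z : J → ℝ) j, 0 ≤ a j * |z j| := fun z j => mul_nonneg (ha j).le (abs_nonneg _)
  have hgood : ∀ z : J → ℝ, (∀ j, |z j| ≤ b j) → HasSum (fun j => a j * |z j|) (h z) ∧ h z ≤ 1 := by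
    intro z hz
    obtain ⟨h1, h2⟩ := hasum (fun j => |z j|) (fun j => abs_nonneg _)
      fun j => (hz j).trans (le_abs_self _)
    have : h z = ∑' j, a j * |z j| := by
      simp only [h, T]
      rw [← ENNReal.ofReal_tsum_of_nonneg (hnn z) h1, ENNReal.toReal_ofReal (tsum_nonneg (hnn z))]
    rw [this]
    exact ⟨h1.hasSum, h2⟩
  let D : Measure (J → ℝ) := m.withDensity fun z => ENNReal.ofReal (h z ^ r)
  let Φ : (J → ℝ) → J → ℝ := fun z => (h z)⁻¹ • z
  have hΦm : Measurable Φ := measurable_pi_iff.2 fun j => hhm.inv.mul (measurable_pi_apply j)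
  have hD : IsFiniteMeasure D := by
    refine ⟨?_⟩
    rw [withDensity_apply _ MeasurableSet.univ, Measure.restrict_univ]
    calc ∫⁻ z, ENNReal.ofReal (h z ^ r) ∂m ≤ ∫⁻ z, 1 ∂m := lintegral_mono_ae (hb.mono fun z hz =>
          ENNReal.ofReal_le_one.2 (Real.rpow_le_one (hh0 z) (hgood z hz).2 hr.le))
      _ < ∞ := by simp
  refine ⟨a, D.map Φ, inferInstance, ha, ?_, fun g hg hom => ?_⟩
  · have hT : ∀ᵐ z ∂(D.map Φ), T z = 1 := by
      rw [ae_map_iff (p := fun z => T z = 1) hΦm.aemeasurable (hTm (measurableSet_singleton 1)),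
        ae_withDensity_iff (hhm.pow_const r).ennreal_ofReal]
      filter_upwards [hb] with z hz hne
      have hpos : 0 < h z := by
        refine (hh0 z).lt_of_ne fun h0 => hne ?_
        rw [← h0, Real.zero_rpow hr.ne', ENNReal.ofReal_zero]
      have hs : HasSum (fun j => a j * |Φ z j|) 1 := by
        have := (hgood z hz).1.mul_left (h z)⁻¹
        rw [inv_mul_cancel₀ hpos.ne'] at this
        convert! this using 2 with j
        simp only [Φ, Pi.smul_apply, smul_eq_mul, abs_mul, abs_inv, abs_of_pos hpos]
        ring
      simp only [T]
      rw [← ENNReal.ofReal_tsum_of_nonneg (hnn _) hs.summable, hs.tsum_eq, ENNReal.ofReal_one]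
    filter_upwards [hT] with z hz
    have hs : Summable fun j => a j * |z j| := by
      have : ∑' j, ENNReal.ofReal (a j * |z j|) ≠ ∞ := by
        change T z ≠ ∞
        rw [hz]; exact ENNReal.one_ne_top
      refine (ENNReal.summable_toReal this).congr fun j => ENNReal.toReal_ofReal (hnn z j)
    have : ∑' j, a j * |z j| = 1 := by
      have h1 := ENNReal.ofReal_tsum_of_nonneg (hnn z) hs
      change _ = T z at h1
      rw [hz, ENNReal.ofReal_eq_one] at h1
      exact h1
    rw [← this]
    exact hs.hasSum
  · refine integral_rpow_map_withDensity hr measurable_id hhm hh0 hg hom (hb.mono fun z hz h0 => ?_)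
    have hs := (hgood z hz).1
    rw [h0, hasSum_zero_iff_of_nonneg (hnn z)] at hs
    have : z = (0 : ℝ) • z := by
      rw [zero_smul]
      funext j
      have := congrFun hs j
      simpa [(ha j).ne'] using this
    change g z = 0
    rw [this, hom 0 le_rfl, zero_mul]

/-- A countable bounded family of sequences in `L^p` which is closed under addition, rational
multiples and absolute values has an ultralimit, dense in an `L^p`-space. -/
theorem exists_Lp_ultralimit {J Ω : Type*} [Countable J] [Nonempty J] [MeasurableSpace Ω]
    (ν : Measure Ω) (𝒰 : Ultrafilter ℕ) (h𝒰 : (𝒰 : Filter ℕ) ≤ atTop) {p : ℝ≥0∞} [Fact (1 ≤ p)]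
    (hp : p ≠ ∞) (x : ℕ → J → Ω → ℝ) (hx : ∀ n j, Measurable (x n j))
    (hInt : ∀ n j, Integrable (fun ω => |x n j ω| ^ p.toReal) ν)
    (hb : ∀ j, ∃ B, ∀ᶠ n in 𝒰, ∫ ω, |x n j ω| ^ p.toReal ∂ν ≤ B)
    (hadd : ∀ i j, ∃ k, ∀ᶠ n in 𝒰, x n k =ᵐ[ν] fun ω => x n i ω + x n j ω)
    (hsmul : ∀ (q : ℚ) i, ∃ k, ∀ᶠ n in 𝒰, x n k =ᵐ[ν] fun ω => q * x n i ω)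
    (habs : ∀ i, ∃ k, ∀ᶠ n in 𝒰, x n k =ᵐ[ν] fun ω => |x n i ω|) :
    ∃ (m : Measure (J → ℝ)) (Z : J → Lp ℝ p m), DenseRange Z ∧
      ∀ i j, Tendsto (fun n => ∫ ω, |x n i ω - x n j ω| ^ p.toReal ∂ν) 𝒰
        (𝓝 (dist (Z i) (Z j) ^ p.toReal)) := by
  classical
  have hr := toReal_pos_of_one_le hp
  obtain ⟨b, m₀, _, hb₀, hlim₀⟩ := exists_limit_measure ν 𝒰 h𝒰 hr x hx hInt hb
  obtain ⟨a, m, _, ha, hsum, heq⟩ := exists_normalized_measure hr m₀ hb₀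
  have hlim : ∀ (s : Finset J) (g : (J → ℝ) → ℝ), Continuous g →
      (∀ c : ℝ, 0 ≤ c → ∀ z, g (c • z) = c * g z) →
      (∀ z z' : J → ℝ, (∀ j ∈ s, z j = z' j) → g z = g z') →
      Tendsto (fun n => ∫ ω, |g (fun j => x n j ω)| ^ p.toReal ∂ν) 𝒰
        (𝓝 (∫ z, |g z| ^ p.toReal ∂m)) := fun s g hg hom hdep => by
    rw [heq g hg.measurable hom]
    exact hlim₀ s g hg hom hdep
  have hbd : ∀ᵐ z ∂m, ∀ j, a j * |z j| ≤ 1 := hsum.mono fun z hz j => by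
    exact le_hasSum hz j fun i _ => mul_nonneg (ha i).le (abs_nonneg _)
  have hmem : ∀ j, MemLp (fun z : J → ℝ => z j) p m := fun j =>
    MemLp.of_bound (measurable_pi_apply j).aestronglyMeasurable (a j)⁻¹ (hbd.mono fun z hz => by
      rw [← one_div, le_div_iff₀ (ha j), mul_comm]; exact hz j)
  let Z : J → Lp ℝ p m := fun j => (hmem j).toLp _
  have hZ : ∀ j, Z j =ᵐ[m] fun z => z j := fun j => (hmem j).coeFn_toLp
  -- a relation between coordinates which holds eventually holds in the limit
  have hrel : ∀ (s : Finset J) (g : (J → ℝ) → ℝ), Continuous g →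
      (∀ c : ℝ, 0 ≤ c → ∀ z, g (c • z) = c * g z) →
      (∀ z z' : J → ℝ, (∀ j ∈ s, z j = z' j) → g z = g z') →
      (∀ᶠ n in 𝒰, ∀ᵐ ω ∂ν, g (fun j => x n j ω) = 0) → ∀ f : Lp ℝ p m, f =ᵐ[m] g → f = 0 := by
    intro s g hg hom hdep hev f hf
    have h0 : ∫ z, |g z| ^ p.toReal ∂m = 0 := by
      refine tendsto_nhds_unique (hlim s g hg hom hdep) (tendsto_const_nhds.congr' ?_)
      filter_upwards [hev] with n hn
      rw [integral_congr_ae (g := fun _ => (0 : ℝ)), integral_zero]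
      filter_upwards [hn] with ω hω
      simp only [hω, abs_zero, Real.zero_rpow hr.ne']
    rw [← Lp_norm_rpow_of_ae hp f hf] at h0
    rwa [Real.rpow_eq_zero (norm_nonneg _) hr.ne', norm_eq_zero] at h0
  have hZadd : ∀ i j, Z i + Z j ∈ range Z := fun i j => by
    obtain ⟨k, hk⟩ := hadd i j
    refine ⟨k, sub_eq_zero.1 (hrel {k, i, j} (fun z => z k - (z i + z j)) (by fun_prop) ?_ ?_ ?_ _
      ?_)⟩
    · intro c _ z; simp only [Pi.smul_apply, smul_eq_mul]; ring
    · intro z z' h; simp only [h k (by simp), h i (by simp), h j (by simp)]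
    · filter_upwards [hk] with n hn
      filter_upwards [hn] with ω hω
      rw [hω, sub_self]
    · filter_upwards [Lp.coeFn_sub (Z k) (Z i + Z j), Lp.coeFn_add (Z i) (Z j), hZ i, hZ j, hZ k]
        with z h1 h2 h3 h4 h5
      rw [h1, Pi.sub_apply, h2, Pi.add_apply, h3, h4, h5]
  have hZsmul : ∀ (q : ℚ) i, (q : ℝ) • Z i ∈ range Z := fun q i => by
    obtain ⟨k, hk⟩ := hsmul q i
    refine ⟨k, sub_eq_zero.1 (hrel {k, i} (fun z => z k - q * z i) (by fun_prop) ?_ ?_ ?_ _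
      ?_)⟩
    · intro c _ z; simp only [Pi.smul_apply, smul_eq_mul]; ring
    · intro z z' h; simp only [h k (by simp), h i (by simp)]
    · filter_upwards [hk] with n hn
      filter_upwards [hn] with ω hω
      rw [hω, sub_self]
    · filter_upwards [Lp.coeFn_sub (Z k) ((q : ℝ) • Z i), Lp.coeFn_smul (q : ℝ) (Z i), hZ i, hZ k]
        with z h1 h2 h3 h5
      rw [h1, Pi.sub_apply, h2, Pi.smul_apply, h3, h5, smul_eq_mul]
  have hZabs : ∀ i, |Z i| ∈ range Z := fun i => by
    obtain ⟨k, hk⟩ := habs i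
    refine ⟨k, sub_eq_zero.1 (hrel {k, i} (fun z => z k - |z i|) (by fun_prop) ?_ ?_ ?_ _
      ?_)⟩
    · intro c hc z
      simp only [Pi.smul_apply, smul_eq_mul, abs_mul, abs_of_nonneg hc]; ring
    · intro z z' h; simp only [h k (by simp), h i (by simp)]
    · filter_upwards [hk] with n hn
      filter_upwards [hn] with ω hω
      rw [hω, sub_self]
    · filter_upwards [Lp.coeFn_sub (Z k) |Z i|, Lp.coeFn_abs (Z i), hZ i, hZ k]
        with z h1 h2 h3 h5
      rw [h1, Pi.sub_apply, h2, h3, h5]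
  have hVsmul : ∀ (c : ℝ) (f : Lp ℝ p m), f ∈ closure (range Z) → c • f ∈ closure (range Z) := by
    intro c f hf
    refine map_mem_closure₂ continuous_smul (Rat.denseRange_cast (𝕜 := ℝ) c) hf ?_
    rintro _ ⟨q, rfl⟩ _ ⟨i, rfl⟩
    exact hZsmul q i
  -- The closure of the coordinates is a closed vector sublattice; rational multiples suffice
  -- because scalar multiplication is continuous. It contains the constants because `∑ a j |z j| =
  -- 1` almost everywhere, hence it is everything.
  let V : Submodule ℝ (Lp ℝ p m) :=
    { carrier := closure (range Z)
      add_mem' := fun {f g} hf hg => map_mem_closure₂ continuous_add hf hg (by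
        rintro _ ⟨i, rfl⟩ _ ⟨j, rfl⟩; exact hZadd i j)
      zero_mem' := by
        obtain ⟨i⟩ := ‹Nonempty J›
        simpa using hVsmul 0 (Z i) (subset_closure ⟨i, rfl⟩)
      smul_mem' := hVsmul }
  have hVabs : ∀ f ∈ V, |f| ∈ V := fun f hf => by
    have hc : Continuous fun f : Lp ℝ p m => |f| := by
      simp only [abs]; fun_prop
    refine map_mem_closure hc hf ?_
    rintro _ ⟨i, rfl⟩
    exact hZabs i
  have hVc : IsClosed (V : Set (Lp ℝ p m)) := isClosed_closure
  have hZV : ∀ j, Z j ∈ V := fun j => subset_closure ⟨j, rfl⟩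
  have hVone : ∃ f ∈ V, f =ᵐ[m] fun _ => (1 : ℝ) := by
    obtain ⟨F, hFmono, hF⟩ := exists_finset_exhaustion J
    refine exists_mem_of_tendsto_ae hp hVc (f := fun k => ∑ j ∈ F k, a j • |Z j|)
      (fun k => V.sum_mem fun j _ => V.smul_mem _ (hVabs _ (hZV j)))
      (u := fun k z => ∑ j ∈ F k, a j * |z j|) (fun k => ?_) ?_ (fun k => ?_)
    · have h1 : ∀ᵐ z ∂m, ∀ j : J, (a j • |Z j| : Lp ℝ p m) z = a j * |z j| := by
        rw [ae_all_iff]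
        intro j
        filter_upwards [Lp.coeFn_smul (a j) |Z j|, Lp.coeFn_abs (Z j), hZ j] with z h1 h2 h3
        rw [h1, Pi.smul_apply, h2, h3, smul_eq_mul]
      filter_upwards [Lp.coeFn_finsetSum (F k) (fun j => a j • |Z j|), h1] with z h2 h3
      rw [h2, Finset.sum_apply]
      exact Finset.sum_congr rfl fun j _ => h3 j
    · filter_upwards [hsum] with z hz
      exact hz.comp (tendsto_atTop_finset_of_monotone hFmono hF)
    · filter_upwards [hsum] with z hz
      have hnn : ∀ j, 0 ≤ a j * |z j| := fun j => mul_nonneg (ha j).le (abs_nonneg _)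
      rw [abs_of_nonneg (Finset.sum_nonneg fun j _ => hnn j)]
      exact sum_le_hasSum _ (fun j _ => hnn j) hz
  have hVtop := closed_sublattice_eq_top hp m V hVc hVabs hVone fun j => ⟨Z j, hZV j, hZ j⟩
  refine ⟨m, Z, fun f => ?_, fun i j => ?_⟩
  · have : f ∈ V := hVtop ▸ Submodule.mem_top
    exact this
  · rw [dist_eq_norm, Lp_norm_rpow_of_ae hp (Z i - Z j) (u := fun z => z i - z j)]
    · refine hlim {i, j} (fun z => z i - z j) (by fun_prop) ?_ ?_
      · intro c _ z; simp only [Pi.smul_apply, smul_eq_mul]; ring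
      · intro z z' h; simp only [h i (by simp), h j (by simp)]
    · filter_upwards [Lp.coeFn_sub (Z i) (Z j), hZ i, hZ j] with z h1 h3 h5
      rw [h1, Pi.sub_apply, h3, h5]

/-! ### Isometric actions from approximate cocycles -/

theorem exists_countable_closed {X ι : Type*} [Countable ι] (op : ι → X → X → X) (x₀ : X) :
    ∃ t : Set X, t.Countable ∧ x₀ ∈ t ∧ ∀ i, ∀ x ∈ t, ∀ y ∈ t, op i x y ∈ t := by
  let A : ℕ → Set X := fun n => (fun s : Set X => s ∪ ⋃ i, image2 (op i) s s)^[n] {x₀}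
  have hA : ∀ n, A (n + 1) = A n ∪ ⋃ i, image2 (op i) (A n) (A n) := fun n =>
    Function.iterate_succ_apply' _ n {x₀}
  have hmono : Monotone A := monotone_nat_of_le_succ fun n => by
    rw [hA]; exact subset_union_left
  refine ⟨⋃ n, A n, countable_iUnion fun n => ?_, mem_iUnion.2 ⟨0, rfl⟩, ?_⟩
  · induction n with
    | zero => exact countable_singleton x₀
    | succ n ih =>
      rw [hA]
      exact ih.union (countable_iUnion fun i => ih.image2 ih _)
  · intro i x hx y hy
    obtain ⟨n, hn⟩ := mem_iUnion.1 hx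
    obtain ⟨k, hk⟩ := mem_iUnion.1 hy
    refine mem_iUnion.2 ⟨max n k + 1, ?_⟩
    rw [hA]
    exact Or.inr (mem_iUnion.2 ⟨i, mem_image2_of_mem (hmono (le_max_left _ _) hn)
      (hmono (le_max_right _ _) hk)⟩)

/-- An isometric action on a dense subset extends. -/
theorem exists_isometric_action {Γ J L : Type*} [Group Γ] [MetricSpace L] [CompleteSpace L]
    {Z : J → L} (hZ : DenseRange Z) (a : Γ → J → J)
    (hiso : ∀ g i j, dist (Z (a g i)) (Z (a g j)) = dist (Z i) (Z j))
    (hmul : ∀ g h j, Z (a (g * h) j) = Z (a g (a h j))) (hone : ∀ j, Z (a 1 j) = Z j) :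
    ∃ α : Γ →* (L ≃ᵢ L), ∀ g j, α g (Z j) = Z (a g j) := by
  let _ : PseudoMetricSpace J := PseudoMetricSpace.induced Z inferInstance
  have hZi : Isometry Z := Isometry.of_dist_eq fun _ _ => rfl
  have hZu : IsUniformInducing Z := hZi.isUniformInducing
  have hext : ∀ g, ∃ U : L → L, Continuous U ∧ ∀ j, U (Z j) = Z (a g j) := fun g => by
    have hf : UniformContinuous fun j => Z (a g j) :=
      (Isometry.of_dist_eq fun i j => hiso g i j : Isometry fun j => Z (a g j)).uniformContinuous
    exact ⟨_, (uniformContinuous_uniformly_extend hZu hZ hf).continuous,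
      fun j => uniformly_extend_of_ind hZu hZ hf j⟩
  choose U hUc hU using hext
  have hUmul : ∀ g h z, U (g * h) z = U g (U h z) := fun g h z => by
    refine congrFun (hZ.equalizer (hUc (g * h)) ((hUc g).comp (hUc h)) ?_) z
    funext j
    simp only [Function.comp_apply, hU, hmul]
  have hUone : ∀ z, U 1 z = z := fun z => by
    refine congrFun (hZ.equalizer (hUc 1) continuous_id ?_) z
    funext j
    simp only [Function.comp_apply, hU, hone, id]
  have hUiso : ∀ g, Isometry (U g) := fun g => Isometry.of_dist_eq fun z z' => by
    refine hZ.induction_on₂ (p := fun z z' => dist (U g z) (U g z') = dist z z') ?_ ?_ z z'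
    · have := hUc g
      exact isClosed_eq (by fun_prop) (by fun_prop)
    · intro i j; simp only [hU, hiso]
  let e : Γ → (L ≃ᵢ L) := fun g =>
    { toFun := U g
      invFun := U g⁻¹
      left_inv := fun z => by rw [← hUmul, inv_mul_cancel, hUone]
      right_inv := fun z => by rw [← hUmul, mul_inv_cancel, hUone]
      isometry_toFun := hUiso g }
  exact ⟨{ toFun := e
           map_one' := IsometryEquiv.ext hUone
           map_mul' := fun g h => IsometryEquiv.ext (hUmul g h) }, fun g j => hU g j⟩

/-! ### Simple functions with values in `L^p` as functions on a product space -/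

/-- The measure `ν` is not assumed σ-finite, so the general exchange of integrals is unavailable.
Since `t` takes finitely many values, the inner integral is a finite sum and the exchange is
additivity. -/
theorem lintegral_prod_simpleFunc {Ω Y B : Type*} [MeasurableSpace Ω] [MeasurableSpace Y]
    (ν : Measure Ω) (μ : Measure Y) [IsFiniteMeasure μ] (t : SimpleFunc Y B) (G : B → Ω → ℝ≥0∞)
    (hG : ∀ b, Measurable (G b)) :
    ∫⁻ z, G (t z.2) z.1 ∂(ν.prod μ) = ∫⁻ y, ∫⁻ ω, G (t y) ω ∂ν ∂μ := by
  have hm : Measurable fun z : Ω × Y => G (t z.2) z.1 :=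
    (t.comp Prod.snd measurable_snd).measurable_bind (fun b z => G b z.1)
      fun b => (hG b).comp measurable_fst
  have key : ∀ f : B → ℝ≥0∞, ∫⁻ y, f (t y) ∂μ = ∑ b ∈ t.range, f b * μ (t ⁻¹' {b}) := fun f => by
    rw [← SimpleFunc.map_lintegral, ← SimpleFunc.lintegral_eq_lintegral]
    rfl
  rw [lintegral_prod _ hm.aemeasurable, key fun b => ∫⁻ ω, G b ω ∂ν]
  simp only [fun ω => key fun b => G b ω]
  rw [lintegral_finsetSum _ fun b _ => (hG b).mul_const _]
  exact Finset.sum_congr rfl fun b _ => lintegral_mul_const _ (hG b)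

theorem ae_prod_simpleFunc {Ω Y B : Type*} [MeasurableSpace Ω] [MeasurableSpace Y]
    (ν : Measure Ω) (μ : Measure Y) [IsFiniteMeasure μ] (t : SimpleFunc Y B) {P : B → Ω → Prop}
    (hP : ∀ b, ∀ᵐ ω ∂ν, P b ω) : ∀ᵐ z ∂(ν.prod μ), P (t z.2) z.1 := by
  have h : ∀ᵐ ω ∂ν, ∀ b ∈ t.range, P b ω := by
    rw [Filter.eventually_all_finset]; exact fun b _ => hP b
  filter_upwards [Measure.quasiMeasurePreserving_fst.ae h] with z hz
  exact hz _ (t.mem_range_self _)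

/-- A simple function with values in `L^p` as a function of two variables. -/
noncomputable def uncurrySimple {Ω Y : Type*} [MeasurableSpace Ω] [MeasurableSpace Y]
    {ν : Measure Ω} {p : ℝ≥0∞} (s : SimpleFunc Y (Lp ℝ p ν)) (z : Ω × Y) : ℝ := s z.2 z.1

theorem measurable_uncurrySimple {Ω Y : Type*} [MeasurableSpace Ω] [MeasurableSpace Y]
    {ν : Measure Ω} {p : ℝ≥0∞} (s : SimpleFunc Y (Lp ℝ p ν)) : Measurable (uncurrySimple s) :=
  (s.comp Prod.snd measurable_snd).measurable_bind (fun b z => b z.1)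
    fun b => (Lp.stronglyMeasurable b).measurable.comp measurable_fst

theorem lintegral_Lp_rpow {Ω : Type*} [MeasurableSpace Ω] {ν : Measure Ω} {p : ℝ≥0∞}
    [hp1 : Fact (1 ≤ p)] (hp : p ≠ ∞) (f : Lp ℝ p ν) {u : Ω → ℝ} (hu : f =ᵐ[ν] u) :
    ∫⁻ ω, ENNReal.ofReal (|u ω| ^ p.toReal) ∂ν = ENNReal.ofReal (‖f‖ ^ p.toReal) := by
  have h0 : p ≠ 0 := (zero_lt_one.trans_le hp1.out).ne'
  have hInt : Integrable (fun ω => |f ω| ^ p.toReal) ν := (Lp.memLp f).integrable_norm_rpow h0 hp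
  rw [Lp_norm_rpow hp, ofReal_integral_eq_lintegral_ofReal hInt
    (Eventually.of_forall fun ω => by positivity)]
  exact lintegral_congr_ae (hu.mono fun ω h => by simp only [h])

theorem integrable_uncurrySimple {Ω Y : Type*} [MeasurableSpace Ω] [MeasurableSpace Y]
    {ν : Measure Ω} (μ : Measure Y) [IsFiniteMeasure μ] {p : ℝ≥0∞} [Fact (1 ≤ p)] (hp : p ≠ ∞)
    (s : SimpleFunc Y (Lp ℝ p ν)) :
    Integrable (fun z => |uncurrySimple s z| ^ p.toReal) (ν.prod μ) := by
  have hm : Measurable fun z => |uncurrySimple s z| ^ p.toReal :=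
    (measurable_uncurrySimple s).abs.pow_const _
  refine ⟨hm.aestronglyMeasurable, ?_⟩
  rw [hasFiniteIntegral_iff_ofReal (Eventually.of_forall fun z => by positivity)]
  have h := lintegral_prod_simpleFunc ν μ s (fun f ω => ENNReal.ofReal (|f ω| ^ p.toReal))
    fun f => ((Lp.stronglyMeasurable f).measurable.norm.pow_const _).ennreal_ofReal
  simp only [uncurrySimple]
  rw [h]
  simp only [fun y => lintegral_Lp_rpow hp (s y) (EventuallyEq.refl _ _)]
  exact (SimpleFunc.integrable_of_isFiniteMeasure (μ := μ)
    (s.map fun f => ‖f‖ ^ p.toReal)).lintegral_lt_top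

theorem integral_uncurrySimple_sub {Ω Y : Type*} [MeasurableSpace Ω] [MeasurableSpace Y]
    {ν : Measure Ω} (μ : Measure Y) [IsFiniteMeasure μ] {p : ℝ≥0∞} [Fact (1 ≤ p)] (hp : p ≠ ∞)
    (s sb : SimpleFunc Y (Lp ℝ p ν)) :
    ∫ z, |uncurrySimple s z - uncurrySimple sb z| ^ p.toReal ∂(ν.prod μ) =
      ∫ y, ‖s y - sb y‖ ^ p.toReal ∂μ := by
  have hm : Measurable fun z => |uncurrySimple s z - uncurrySimple sb z| ^ p.toReal :=
    ((measurable_uncurrySimple s).sub (measurable_uncurrySimple sb)).abs.pow_const _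
  have hm' : AEStronglyMeasurable (fun y => ‖s y - sb y‖ ^ p.toReal) μ :=
    ((s.pair sb).map fun q : Lp ℝ p ν × Lp ℝ p ν => ‖q.1 - q.2‖ ^ p.toReal).aestronglyMeasurable
  rw [integral_eq_lintegral_of_nonneg_ae (Eventually.of_forall fun z => by positivity)
    hm.aestronglyMeasurable, integral_eq_lintegral_of_nonneg_ae
    (Eventually.of_forall fun z => by positivity) hm']
  have h := lintegral_prod_simpleFunc ν μ (s.pair sb)
    (fun q ω => ENNReal.ofReal (|q.1 ω - q.2 ω| ^ p.toReal))
    fun q => (((Lp.stronglyMeasurable q.1).measurable.sub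
      (Lp.stronglyMeasurable q.2).measurable).norm.pow_const _).ennreal_ofReal
  simp only [SimpleFunc.pair_apply] at h
  simp only [uncurrySimple]
  rw [h]
  congr 1
  refine lintegral_congr fun y => ?_
  exact lintegral_Lp_rpow hp (s y - sb y) (Lp.coeFn_sub (s y) (sb y))

/-- The simple function `y ↦ c y (s (g⁻¹ y))`. -/
noncomputable def twistedShift {Γ Y E : Type*} [Group Γ] [MeasurableSpace Y] [MulAction Γ Y]
    [MeasurableConstSMul Γ Y] [PseudoEMetricSpace E] (c : SimpleFunc Y (E ≃ᵢ E)) (g : Γ)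
    (s : SimpleFunc Y E) : SimpleFunc Y E :=
  (c.pair (s.comp (fun y => g⁻¹ • y) (measurable_const_smul g⁻¹))).map fun q => q.1 q.2

theorem twistedShift_apply {Γ Y E : Type*} [Group Γ] [MeasurableSpace Y] [MulAction Γ Y]
    [MeasurableConstSMul Γ Y] [PseudoEMetricSpace E] (c : SimpleFunc Y (E ≃ᵢ E)) (g : Γ)
    (s : SimpleFunc Y E) (y : Y) : twistedShift c g s y = c y (s (g⁻¹ • y)) := rfl

/-- By Mazur–Ulam every surjective isometry is affine. Properness of one orbit map passes to all
orbits, which stay at bounded distance from each other. -/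
theorem hasProperAffineAction_of_isometric {Γ E : Type*} [Group Γ] [NormedAddCommGroup E]
    [NormedSpace ℝ E] (α : Γ →* (E ≃ᵢ E)) {lo : Γ → ℝ} (hlo : ∀ R, {g | lo g ≤ R}.Finite) (z : E)
    (hα : ∀ g, lo g ≤ dist (α g z) z) : HasProperAffineAction Γ E := by
  refine ⟨{ toFun := fun g => (α g).toRealAffineIsometryEquiv
            map_one' := AffineIsometryEquiv.ext fun x => by simp
            map_mul' := fun g h => AffineIsometryEquiv.ext fun x => by simp }, fun e c R => ?_⟩
  refine (hlo (dist z e + R + dist c z)).subset fun g hg => (hα g).trans ?_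
  have hg' : dist (α g e) c ≤ R := hg
  have h1 := dist_triangle4 (α g z) (α g e) c z
  rw [(α g).dist_eq] at h1
  linarith

/-- A sequence of asymptotic cocycles over a measure-preserving action, with values in the isometries
of an `L^p`-space and with uniformly proper growth, yields a proper affine isometric action. -/
theorem propertyPLp_of_cocycles {Γ : Type u} [Group Γ] [Countable Γ] {Y : Type v}
    [MeasurableSpace Y] [MulAction Γ Y] [MeasurableConstSMul Γ Y] (μ : Measure Y)
    [IsProbabilityMeasure μ] [SMulInvariantMeasure Γ Y μ] {Ω : Type (max v w)} [MeasurableSpace Ω]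
    (ν : Measure Ω) {p : ℝ≥0∞} [Fact (1 ≤ p)] (hp : p ≠ ∞)
    (c : ℕ → Γ → SimpleFunc Y (Lp ℝ p ν ≃ᵢ Lp ℝ p ν))
    (hc : ∀ g h, ∀ᶠ n in atTop, ∀ y e, c n g y (c n h (g⁻¹ • y) e) = c n (g * h) y e)
    {lo up : Γ → ℝ} (hlo0 : ∀ g, 0 ≤ lo g) (hlo : ∀ R, {g | lo g ≤ R}.Finite)
    (hbd : ∀ g, ∀ᶠ n in atTop, ∀ y, lo g ≤ ‖c n g y 0‖ ∧ ‖c n g y 0‖ ≤ up g) :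
    PropertyPLp.{u, max v w} p Γ := by
  have hr := toReal_pos_of_one_le hp
  let 𝒰 : Ultrafilter ℕ := Ultrafilter.of atTop
  have h𝒰 : (𝒰 : Filter ℕ) ≤ atTop := Ultrafilter.of_le _
  -- Sequences of simple functions `Y → L^p(ν)` are the raw material of the ultralimit. Simple
  -- functions keep every measurability question finite.
  let X : Type (max v w) := ℕ → SimpleFunc Y (Lp ℝ p ν)
  have hX0 : ∀ n y, (0 : X) n y = 0 := fun _ _ => rfl
  let act : Γ → X → X := fun g s n => twistedShift (c n g) g (s n)
  let sm : ℚ → X → X := fun q s n => (s n).map fun e => (q : ℝ) • e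
  let ab : X → X := fun s n => (s n).map fun e => |e|
  let bd : Set X := {s | ∃ C : ℝ, ∀ᶠ n in atTop, ∀ y, ‖s n y‖ ≤ C}
  -- A countable family closed under the group action as well as the lattice operations; unary
  -- operations ignore their second argument, and the Boolean selects addition or absolute value.
  obtain ⟨t, htc, ht0, ht⟩ := exists_countable_closed
    (Sum.elim (fun q s _ => sm q s) (Sum.elim (fun g s _ => act g s)
      (fun b s s' => if b then s + s' else ab s)) : ℚ ⊕ Γ ⊕ Bool → X → X → X) 0
  let J := ↥(t ∩ bd)
  have : Countable J := (htc.mono inter_subset_left).to_subtype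
  have h0 : (0 : X) ∈ t ∩ bd := ⟨ht0, 0, Eventually.of_forall fun n y => by rw [hX0, norm_zero]⟩
  have : Nonempty J := ⟨⟨0, h0⟩⟩
  have hadd : ∀ s ∈ t ∩ bd, ∀ s' ∈ t ∩ bd, s + s' ∈ t ∩ bd := by
    rintro s ⟨hs, C, hC⟩ s' ⟨hs', C', hC'⟩
    refine ⟨by simpa using ht (Sum.inr (Sum.inr true)) s hs s' hs', C + C', ?_⟩
    filter_upwards [hC, hC'] with n h1 h2 y
    exact (norm_add_le _ _).trans (add_le_add (h1 y) (h2 y))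
  have hsm : ∀ q, ∀ s ∈ t ∩ bd, sm q s ∈ t ∩ bd := by
    rintro q s ⟨hs, C, hC⟩
    refine ⟨by simpa using ht (Sum.inl q) s hs s hs, |(q : ℝ)| * C, ?_⟩
    filter_upwards [hC] with n h1 y
    simp only [sm, SimpleFunc.map_apply, norm_smul, Real.norm_eq_abs]
    exact mul_le_mul_of_nonneg_left (h1 y) (abs_nonneg _)
  have hab : ∀ s ∈ t ∩ bd, ab s ∈ t ∩ bd := by
    rintro s ⟨hs, C, hC⟩
    refine ⟨by simpa using ht (Sum.inr (Sum.inr false)) s hs s hs, C, ?_⟩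
    filter_upwards [hC] with n h1 y
    simp only [ab, SimpleFunc.map_apply, norm_abs_eq_norm]
    exact h1 y
  have hact : ∀ g, ∀ s ∈ t ∩ bd, act g s ∈ t ∩ bd := by
    rintro g s ⟨hs, C, hC⟩
    refine ⟨by simpa using ht (Sum.inr (Sum.inl g)) s hs s hs, C + up g, ?_⟩
    filter_upwards [hC, hbd g] with n h1 h2 y
    have h3 := (c n g y).dist_eq (s n (g⁻¹ • y)) 0
    rw [dist_zero_right, dist_eq_norm] at h3
    calc ‖act g s n y‖ = ‖(c n g y (s n (g⁻¹ • y)) - c n g y 0) + c n g y 0‖ := by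
          rw [sub_add_cancel]; rfl
      _ ≤ ‖s n (g⁻¹ • y)‖ + ‖c n g y 0‖ := by rw [← h3]; exact norm_add_le _ _
      _ ≤ C + up g := add_le_add (h1 _) (h2 y).2
  let x : ℕ → J → Ω × Y → ℝ := fun n j => uncurrySimple (j.1 n)
  have hdist : ∀ n (i j : J), ∫ z, |x n i z - x n j z| ^ p.toReal ∂(ν.prod μ) =
      ∫ y, ‖i.1 n y - j.1 n y‖ ^ p.toReal ∂μ := fun n i j => integral_uncurrySimple_sub μ hp _ _
  have hbound : ∀ j : J, ∃ B, ∀ᶠ n in (𝒰 : Filter ℕ),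
      ∫ z, |x n j z| ^ p.toReal ∂(ν.prod μ) ≤ B := by
    rintro ⟨s, hs⟩
    obtain ⟨C, hC⟩ := hs.2
    refine ⟨C ^ p.toReal, (hC.filter_mono h𝒰).mono fun n hn => ?_⟩
    have e : ∫ z, |x n ⟨s, hs⟩ z| ^ p.toReal ∂(ν.prod μ) = ∫ y, ‖s n y‖ ^ p.toReal ∂μ := by
      have := hdist n ⟨s, hs⟩ ⟨0, h0⟩
      simp only [hX0, sub_zero] at this
      rw [← this]
      refine integral_congr_ae ?_
      -- The chosen representative of the zero class vanishes only almost everywhere.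
      filter_upwards [ae_prod_simpleFunc ν μ (0 : SimpleFunc Y (Lp ℝ p ν))
        (P := fun f ω => f = 0 → f ω = 0) fun f => by
          by_cases hf : f = 0
          · subst hf
            filter_upwards [Lp.coeFn_zero ℝ p ν] with ω h _ using h
          · exact Eventually.of_forall fun ω h => absurd h hf] with z hz
      have : x n ⟨0, h0⟩ z = 0 := hz rfl
      rw [this, sub_zero]
    rw [e]
    calc ∫ y, ‖s n y‖ ^ p.toReal ∂μ ≤ ∫ _, C ^ p.toReal ∂μ :=
          integral_mono (SimpleFunc.integrable_of_isFiniteMeasure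
            ((s n).map fun f => ‖f‖ ^ p.toReal)) (integrable_const _)
            fun y => Real.rpow_le_rpow (norm_nonneg _) (hn y) hr.le
      _ = C ^ p.toReal := by simp
  obtain ⟨m, Z, hZ, hlim⟩ := exists_Lp_ultralimit (ν.prod μ) 𝒰 h𝒰 hp x
    (fun n j => measurable_uncurrySimple _) (fun n j => integrable_uncurrySimple μ hp _) hbound
    (fun i j => ⟨⟨i.1 + j.1, hadd _ i.2 _ j.2⟩, Eventually.of_forall fun n =>
      ae_prod_simpleFunc ν μ ((i.1 n).pair (j.1 n)) (P := fun q ω => (q.1 + q.2) ω = q.1 ω + q.2 ω)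
        fun q => Lp.coeFn_add _ _⟩)
    (fun q i => ⟨⟨sm q i.1, hsm q _ i.2⟩, Eventually.of_forall fun n =>
      ae_prod_simpleFunc ν μ (i.1 n) (P := fun f ω => ((q : ℝ) • f) ω = q * f ω)
        fun f => Lp.coeFn_smul _ _⟩)
    (fun i => ⟨⟨ab i.1, hab _ i.2⟩, Eventually.of_forall fun n =>
      ae_prod_simpleFunc ν μ (i.1 n) (P := fun f ω => |f| ω = |f ω|) fun f => Lp.coeFn_abs _⟩)
  simp only [hdist] at hlim
  have hinj : ∀ {A B : ℝ}, 0 ≤ A → 0 ≤ B → A ^ p.toReal = B ^ p.toReal → A = B :=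
    fun hA hB h => (Real.rpow_left_inj hA hB hr.ne').1 h
  have heqZ : ∀ i j : J, (∀ᶠ n in atTop, ∀ y, i.1 n y = j.1 n y) → Z i = Z j := fun i j h => by
    rw [← dist_eq_zero]
    refine hinj dist_nonneg le_rfl (tendsto_nhds_unique (hlim i j) ?_)
    refine tendsto_const_nhds.congr' ((h.filter_mono h𝒰).mono fun n hn => ?_)
    simp [hn, Real.zero_rpow hr.ne']
  let a : Γ → J → J := fun g j => ⟨act g j.1, hact g _ j.2⟩
  obtain ⟨α, hα⟩ := exists_isometric_action hZ a
    (fun g i j => by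
      refine hinj dist_nonneg dist_nonneg (tendsto_nhds_unique (hlim _ _) ?_)
      refine (hlim i j).congr fun n => ?_
      -- Invariance of `μ` absorbs the shift by `g⁻¹`, and each `c n g y` is an isometry.
      rw [← integral_smul_eq_self (μ := μ) (fun y => ‖i.1 n y - j.1 n y‖ ^ p.toReal) (g := g⁻¹)]
      refine integral_congr_ae (Eventually.of_forall fun y => ?_)
      simp only [a, act, twistedShift_apply, ← dist_eq_norm, IsometryEquiv.dist_eq])
    (fun g h j => heqZ _ _ (by
      filter_upwards [hc g h] with n hn y
      simp only [a, act, twistedShift_apply, hn, mul_inv_rev, mul_smul]))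
    (fun j => heqZ _ _ (by
      -- The cocycle identity for `(1, 1)` says that `c n 1 y` is idempotent; being injective, it is
      -- the identity.
      filter_upwards [hc 1 1] with n hn y
      simp only [a, act, twistedShift_apply]
      refine (c n 1 y).injective ?_
      have := hn y (j.1 n ((1 : Γ)⁻¹ • y))
      simpa using this))
  refine ⟨J → ℝ, inferInstance, m, hasProperAffineAction_of_isometric α hlo (Z ⟨0, h0⟩) fun g => ?_⟩
  rw [hα]
  refine (Real.rpow_le_rpow_iff (hlo0 g) dist_nonneg hr).1 (ge_of_tendsto (hlim _ _) ?_)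
  filter_upwards [(hbd g).filter_mono h𝒰] with n hn
  have e : ∀ y, ‖(a g ⟨0, h0⟩).1 n y - (0 : X) n y‖ = ‖c n g y 0‖ := fun y => by
    simp only [a, act, twistedShift_apply, hX0, sub_zero]
  simp only [e]
  calc lo g ^ p.toReal = ∫ _, lo g ^ p.toReal ∂μ := by simp
    _ ≤ ∫ y, ‖c n g y 0‖ ^ p.toReal ∂μ := integral_mono (integrable_const _)
      (SimpleFunc.integrable_of_isFiniteMeasure ((c n g).map fun T : Lp ℝ p ν ≃ᵢ Lp ℝ p ν => ‖T 0‖ ^ p.toReal))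
      fun y => Real.rpow_le_rpow (hlo0 g) (hn y).1 hr.le

/-! ### Word length -/

/-- A length function on `Γ` with finite balls, which is the word length for `S`. -/
structure IsWordLength {Γ : Type*} [Group Γ] (S : Set Γ) (ℓ : Γ → ℕ) : Prop where
  one : ℓ 1 = 0
  mul : ∀ g h, ℓ (g * h) ≤ ℓ g + ℓ h
  inv : ∀ g, ℓ g⁻¹ = ℓ g
  gen : ∀ s ∈ S, ℓ s ≤ 1
  finite : ∀ n, {g | ℓ g ≤ n}.Finite
  induction : ∀ Q : Γ → ℕ → Prop, Q 1 0 → (∀ g n, Q g n → Q g (n + 1)) →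
    (∀ s ∈ S, ∀ g n, Q g n → Q (s * g) (n + 1) ∧ Q (s⁻¹ * g) (n + 1)) → ∀ g, Q g (ℓ g)

open scoped Pointwise in
-- The length of `g` is the least `n` with `g ∈ B ^ n`, where `B` is `S` made symmetric with `1`
-- adjoined. Adjoining `1` makes the powers of `B` increase, so that they are the balls.
theorem exists_isWordLength {Γ : Type*} [Group Γ] {S : Set Γ} (hS : S.Finite)
    (hgen : Subgroup.closure S = ⊤) : ∃ ℓ : Γ → ℕ, IsWordLength S ℓ := by
  classical
  let B : Set Γ := S ∪ S⁻¹ ∪ {1}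
  have hB1 : (1 : Γ) ∈ B := Or.inr rfl
  have hBinv : ∀ g ∈ B, g⁻¹ ∈ B := by
    rintro g ((h | h) | h)
    · exact Or.inl (Or.inr (by simpa using h))
    · exact Or.inl (Or.inl h)
    · have : g = 1 := h
      subst this
      simpa using hB1
  have hBfin : B.Finite := (hS.union hS.inv).union (finite_singleton 1)
  have hpowinv : ∀ n, ∀ g ∈ B ^ n, g⁻¹ ∈ B ^ n := by
    intro n
    induction n with
    | zero => intro g hg; simpa using hg
    | succ n ih =>
      intro g hg
      rw [pow_succ] at hg
      obtain ⟨a, ha, b, hb, rfl⟩ := hg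
      rw [pow_succ', mul_inv_rev]
      exact mul_mem_mul (hBinv b hb) (ih a ha)
  have hfinpow : ∀ n, (B ^ n).Finite := by
    intro n
    induction n with
    | zero => simp
    | succ n ih => rw [pow_succ]; exact ih.mul hBfin
  have hmono : ∀ {m n : ℕ}, m ≤ n → B ^ m ⊆ B ^ n := fun h => pow_subset_pow_right hB1 h
  have hex : ∀ g : Γ, ∃ n : ℕ, g ∈ B ^ n := by
    intro g
    have hg : g ∈ Subgroup.closure S := hgen ▸ Subgroup.mem_top g
    induction hg using Subgroup.closure_induction with
    | mem x hx => exact ⟨1, by rw [pow_one]; exact Or.inl (Or.inl hx)⟩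
    | one => exact ⟨0, by simp⟩
    | mul x y _ _ hx hy =>
      obtain ⟨m, hm⟩ := hx
      obtain ⟨n, hn⟩ := hy
      exact ⟨m + n, by rw [pow_add]; exact mul_mem_mul hm hn⟩
    | inv x _ hx =>
      obtain ⟨m, hm⟩ := hx
      exact ⟨m, hpowinv m x hm⟩
  have hle : ∀ g n, g ∈ B ^ n → Nat.find (hex g) ≤ n := fun g n h => Nat.find_min' _ h
  refine ⟨fun g => Nat.find (hex g), ⟨?_, ?_, ?_, ?_, ?_, ?_⟩⟩
  · exact Nat.le_zero.1 (hle 1 0 (by simp))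
  · intro g h
    exact hle _ _ (by rw [pow_add]; exact mul_mem_mul (Nat.find_spec (hex g)) (Nat.find_spec (hex h)))
  · intro g
    refine le_antisymm (hle _ _ (hpowinv _ _ (Nat.find_spec (hex g)))) (hle _ _ ?_)
    simpa using hpowinv _ _ (Nat.find_spec (hex g⁻¹))
  · intro s hs
    exact hle s 1 (by rw [pow_one]; exact Or.inl (Or.inl hs))
  · intro n
    exact (hfinpow n).subset fun g hg => hmono hg (Nat.find_spec (hex g))
  · intro Q h0 hsucc hstep g
    have : ∀ n, ∀ g ∈ B ^ n, Q g n := by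
      intro n
      induction n with
      | zero => intro g hg; have : g = 1 := by simpa using hg
                rwa [this]
      | succ n ih =>
        intro g hg
        rw [pow_succ'] at hg
        obtain ⟨s, hs, a, ha, rfl⟩ := hg
        have hQ := ih a ha
        rcases hs with (h | h) | h
        · exact (hstep s h a n hQ).1
        · simpa using (hstep s⁻¹ h a n hQ).2
        · have : s = 1 := h
          subst this
          simpa using hsucc _ _ hQ
    exact this _ g (Nat.find_spec (hex g))

/-! ### The geometry of warped cones over linearisable actions -/

/-- The distance on the cone over `Y` induced by a map `ι : Y → E`, through
`(r, y) ↦ (r ι(y), r)`. -/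
noncomputable def coneDist {Y : Type v} {E : Type w} [NormedAddCommGroup E] [NormedSpace ℝ E]
    (ι : Y → E) (x x' : InfiniteCone Y) : ℝ :=
  ‖x.radius • ι x.point - x'.radius • ι x'.point‖ + |x.radius - x'.radius|

section ConeDist

variable {Y : Type v} {E : Type w} [NormedAddCommGroup E] [NormedSpace ℝ E]

theorem coneDist_nonneg (ι : Y → E) (x x' : InfiniteCone Y) : 0 ≤ coneDist ι x x' := by
  unfold coneDist; positivity

theorem coneDist_self (ι : Y → E) (x : InfiniteCone Y) : coneDist ι x x = 0 := by
  simp [coneDist]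

theorem coneDist_comm (ι : Y → E) (x x' : InfiniteCone Y) : coneDist ι x x' = coneDist ι x' x := by
  unfold coneDist; rw [norm_sub_rev, abs_sub_comm]

theorem coneDist_triangle (ι : Y → E) (x y z : InfiniteCone Y) :
    coneDist ι x z ≤ coneDist ι x y + coneDist ι y z := by
  unfold coneDist
  have h1 := norm_sub_le_norm_sub_add_norm_sub (x.radius • ι x.point) (y.radius • ι y.point)
    (z.radius • ι z.point)
  have h2 := abs_sub_le x.radius y.radius z.radius
  linarith

theorem coneDist_smul {Γ : Type u} [Group Γ] [MulAction Γ Y] {π : Γ →* (E ≃ₗᵢ[ℝ] E)} {ι : Y → E}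
    (hι : ∀ g y, ι (g • y) = π g (ι y)) (g : Γ) (x x' : InfiniteCone Y) :
    coneDist ι (g • x) (g • x') = coneDist ι x x' := by
  change ‖x.radius • ι (g • x.point) - x'.radius • ι (g • x'.point)‖ + |x.radius - x'.radius| = _
  rw [hι, hι, ← map_smul, ← map_smul, ← map_sub, LinearIsometryEquiv.norm_map]
  rfl

theorem InfiniteCone.dist_def [MetricSpace Y] [CompactSpace Y] (x x' : InfiniteCone Y) :
    dist x x' = |x.radius - x'.radius| * Metric.diam (univ : Set Y) +
      min x.radius x'.radius * dist x.point x'.point := rfl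

theorem exists_norm_le_of_lipschitz {F : Type*} [SeminormedAddCommGroup F] [MetricSpace Y]
    [CompactSpace Y] {ι : Y → F} {K : ℝ≥0} (h : LipschitzWith K ι) : ∃ B : ℝ, 0 ≤ B ∧ ∀ y, ‖ι y‖ ≤ B := by
  obtain ⟨B, hB⟩ := isCompact_univ.exists_bound_of_continuousOn h.continuous.continuousOn
  exact ⟨|B|, abs_nonneg _, fun y => (hB y (mem_univ y)).trans (le_abs_self B)⟩

/-- Positive diameter is what lets the cone metric see the radial direction. The angular part is
compared at the smaller of the two radii, and the remaining radial difference is multiplied by a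
bound for `‖ι‖`. -/
theorem exists_mul_coneDist_le [MetricSpace Y] [CompactSpace Y] {ι : Y → E} {K : ℝ≥0}
    (h : LipschitzWith K ι) (hd : 0 < Metric.diam (univ : Set Y)) :
    ∃ c : ℝ, 0 < c ∧ ∀ x x' : InfiniteCone Y, c * coneDist ι x x' ≤ dist x x' := by
  obtain ⟨B, hB0, hB⟩ := exists_norm_le_of_lipschitz h
  have hM : 0 < (K : ℝ) + (B + 1) / Metric.diam (univ : Set Y) := by positivity
  refine ⟨((K : ℝ) + (B + 1) / Metric.diam (univ : Set Y))⁻¹, inv_pos.2 hM, fun x x' => ?_⟩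
  rw [inv_mul_le_iff₀ hM]
  have hmin : 0 < min x.radius x'.radius := lt_min x.radius_pos x'.radius_pos
  have hnorm : ‖x.radius • ι x.point - x'.radius • ι x'.point‖ ≤
      min x.radius x'.radius * (K * dist x.point x'.point) + |x.radius - x'.radius| * B := by
    have hK : ‖ι x.point - ι x'.point‖ ≤ K * dist x.point x'.point := by
      rw [← dist_eq_norm]; exact h.dist_le_mul _ _
    rcases le_total x.radius x'.radius with hle | hle
    · rw [min_eq_left hle]
      calc ‖x.radius • ι x.point - x'.radius • ι x'.point‖
          = ‖x.radius • (ι x.point - ι x'.point) + (x.radius - x'.radius) • ι x'.point‖ := by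
            congr 1; module
        _ ≤ x.radius * ‖ι x.point - ι x'.point‖ + |x.radius - x'.radius| * ‖ι x'.point‖ := by
            refine (norm_add_le _ _).trans_eq ?_
            rw [norm_smul, norm_smul, Real.norm_of_nonneg x.radius_pos.le, Real.norm_eq_abs]
        _ ≤ _ := add_le_add (mul_le_mul_of_nonneg_left hK x.radius_pos.le)
            (mul_le_mul_of_nonneg_left (hB _) (abs_nonneg _))
    · rw [min_eq_right hle]
      calc ‖x.radius • ι x.point - x'.radius • ι x'.point‖
          = ‖x'.radius • (ι x.point - ι x'.point) + (x.radius - x'.radius) • ι x.point‖ := by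
            congr 1; module
        _ ≤ x'.radius * ‖ι x.point - ι x'.point‖ + |x.radius - x'.radius| * ‖ι x.point‖ := by
            refine (norm_add_le _ _).trans_eq ?_
            rw [norm_smul, norm_smul, Real.norm_of_nonneg x'.radius_pos.le, Real.norm_eq_abs]
        _ ≤ _ := add_le_add (mul_le_mul_of_nonneg_left hK x'.radius_pos.le)
            (mul_le_mul_of_nonneg_left (hB _) (abs_nonneg _))
  rw [coneDist, InfiniteCone.dist_def]
  have h1 : 0 ≤ K * (|x.radius - x'.radius| * Metric.diam (univ : Set Y)) := by positivity
  have h2 : 0 ≤ (B + 1) / Metric.diam (univ : Set Y) *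
    (min x.radius x'.radius * dist x.point x'.point) := by positivity
  have h3 : (B + 1) / Metric.diam (univ : Set Y) *
      (|x.radius - x'.radius| * Metric.diam (univ : Set Y)) = (B + 1) * |x.radius - x'.radius| := by
    field_simp
  linarith

theorem exists_dist_le_mul_coneDist [MetricSpace Y] [CompactSpace Y] {ι : Y → E} {K K' : ℝ≥0}
    (h : LipschitzWith K ι) (h' : AntilipschitzWith K' ι) :
    ∃ C : ℝ, 0 ≤ C ∧ ∀ x x' : InfiniteCone Y, dist x x' ≤ C * coneDist ι x x' := by
  obtain ⟨B, hB0, hB⟩ := exists_norm_le_of_lipschitz h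
  have hdiam : 0 ≤ Metric.diam (univ : Set Y) := Metric.diam_nonneg
  refine ⟨Metric.diam (univ : Set Y) + K' * (1 + B), by positivity, fun x x' => ?_⟩
  have hK : dist x.point x'.point ≤ K' * ‖ι x.point - ι x'.point‖ := by
    rw [← dist_eq_norm]; exact h'.le_mul_dist _ _
  have hmin : 0 < min x.radius x'.radius := lt_min x.radius_pos x'.radius_pos
  have hnorm : min x.radius x'.radius * ‖ι x.point - ι x'.point‖ ≤
      ‖x.radius • ι x.point - x'.radius • ι x'.point‖ + |x.radius - x'.radius| * B := by
    rw [← Real.norm_of_nonneg hmin.le, ← norm_smul]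
    rcases le_total x.radius x'.radius with hle | hle
    · rw [min_eq_left hle]
      calc ‖x.radius • (ι x.point - ι x'.point)‖
          = ‖(x.radius • ι x.point - x'.radius • ι x'.point) -
              (x.radius - x'.radius) • ι x'.point‖ := by congr 1; module
        _ ≤ ‖x.radius • ι x.point - x'.radius • ι x'.point‖ +
              |x.radius - x'.radius| * ‖ι x'.point‖ := by
            refine (norm_sub_le _ _).trans_eq ?_
            rw [norm_smul, Real.norm_eq_abs]
        _ ≤ _ := by gcongr; exact hB _
    · rw [min_eq_right hle]
      calc ‖x'.radius • (ι x.point - ι x'.point)‖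
          = ‖(x.radius • ι x.point - x'.radius • ι x'.point) -
              (x.radius - x'.radius) • ι x.point‖ := by congr 1; module
        _ ≤ ‖x.radius • ι x.point - x'.radius • ι x'.point‖ +
              |x.radius - x'.radius| * ‖ι x.point‖ := by
            refine (norm_sub_le _ _).trans_eq ?_
            rw [norm_smul, Real.norm_eq_abs]
        _ ≤ _ := by gcongr; exact hB _
  rw [coneDist, InfiniteCone.dist_def]
  have hm : min x.radius x'.radius * dist x.point x'.point ≤
      K' * (‖x.radius • ι x.point - x'.radius • ι x'.point‖ + |x.radius - x'.radius| * B) :=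
    calc min x.radius x'.radius * dist x.point x'.point
        ≤ min x.radius x'.radius * (K' * ‖ι x.point - ι x'.point‖) := by gcongr
      _ = K' * (min x.radius x'.radius * ‖ι x.point - ι x'.point‖) := by ring
      _ ≤ _ := by gcongr
  have h1 : 0 ≤ Metric.diam (univ : Set Y) * ‖x.radius • ι x.point - x'.radius • ι x'.point‖ := by
    positivity
  have h2 : 0 ≤ K' * |x.radius - x'.radius| := by positivity
  have h3 : 0 ≤ K' * B * ‖x.radius • ι x.point - x'.radius • ι x'.point‖ := by positivity
  linarith

end ConeDist

/-- The properties of the warped cone of a free linearisable action: the warped distance is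
controlled by the word length and by the invariant distance `coneDist ι`. -/
structure IsConeModel {Γ : Type u} {Y : Type v} {E : Type w} [Group Γ] [MulAction Γ Y]
    [MetricSpace Y] [CompactSpace Y] [NormedAddCommGroup E] [NormedSpace ℝ E] (S : Set Γ)
    (ℓ : Γ → ℕ) (ι : Y → E) (c C : ℝ) : Prop where
  pos : 0 < c
  nonneg : 0 ≤ C
  exists_lt : ∀ (x x' : InfiniteCone Y) (ρ : ℝ), warpedMetric S x x' < ρ →
    ∃ g : Γ, ℓ g + c * coneDist ι (g • x) x' < ρ
  le : ∀ (g : Γ) (x x' : InfiniteCone Y), warpedMetric S x x' ≤ ℓ g + C * coneDist ι (g • x) x'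
  separated : ∀ M : ℝ, ∃ R : ℝ, ∀ x : InfiniteCone Y, R ≤ x.radius → ∀ g : Γ, (ℓ g : ℝ) ≤ M →
    c * coneDist ι (g • x) x ≤ M → g = 1

section WarpedMetric

variable {Γ : Type u} {Y : Type v} [Group Γ] [MulAction Γ Y] [MetricSpace Y] [CompactSpace Y]
  {S : Set Γ}

theorem warpedMetric_le_dist (x x' : InfiniteCone Y) : warpedMetric S x x' ≤ dist x x' :=
  (isGreatest_warpedMetric S).1.1 x x'

theorem warpedMetric_smul_le {ℓ : Γ → ℕ} (hℓ : IsWordLength S ℓ) (g : Γ) (x : InfiniteCone Y) :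
    warpedMetric S x (g • x) ≤ ℓ g := by
  revert x
  refine hℓ.induction (fun g n => ∀ x : InfiniteCone Y, warpedMetric S x (g • x) ≤ n) ?_ ?_ ?_ g
  · intro x; simp
  · intro g n h x
    refine (h x).trans ?_
    push_cast; linarith
  · intro s hs g n h
    have hgen : ∀ x : InfiniteCone Y, warpedMetric S x (s • x) ≤ 1 :=
      (isGreatest_warpedMetric S).1.2 s hs
    refine ⟨fun x => ?_, fun x => ?_⟩
    · rw [mul_smul]
      push_cast
      exact ((warpedMetric S).triangle x (g • x) _).trans (add_le_add (h x) (hgen _))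
    · rw [mul_smul]
      push_cast
      refine ((warpedMetric S).triangle x (g • x) _).trans (add_le_add (h x) ?_)
      rw [(warpedMetric S).symm]
      simpa using hgen (s⁻¹ • g • x)

end WarpedMetric

/-- The infimum over `g` of `ℓ g + c * coneDist ι (g • x) x'` is a pseudometric because `coneDist ι`
is Γ-invariant. It satisfies the two constraints defining the warped metric, hence lies below it.
The upper bound is the triangle inequality through `g • x`. For separation, freeness and compactness
give `‖ι (g • y) - ι y‖` a positive minimum over `Y` for each `g ≠ 1`; it is scaled by the radius,
and only finitely many `g` have bounded length. -/
theorem exists_isConeModel {Γ : Type u} {Y : Type v} {E : Type w} [Group Γ] [MulAction Γ Y]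
    [MetricSpace Y] [CompactSpace Y] [NormedAddCommGroup E] [NormedSpace ℝ E]
    [ContinuousConstSMul Γ Y] {S : Set Γ} {ℓ : Γ → ℕ} (hℓ : IsWordLength S ℓ)
    (hfree : ∀ (g : Γ) (y : Y), g • y = y → g = 1) (hd : 0 < Metric.diam (univ : Set Y))
    {π : Γ →* (E ≃ₗᵢ[ℝ] E)} {ι : Y → E} (hι : ∀ g y, ι (g • y) = π g (ι y)) {K K' : ℝ≥0}
    (hK : LipschitzWith K ι) (hK' : AntilipschitzWith K' ι) :
    ∃ c C : ℝ, IsConeModel S ℓ ι c C := by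
  obtain ⟨c, hc, hcle⟩ := exists_mul_coneDist_le hK hd
  obtain ⟨C, hC, hleC⟩ := exists_dist_le_mul_coneDist hK hK'
  have hnn : ∀ (x x' : InfiniteCone Y) (g : Γ), 0 ≤ (ℓ g : ℝ) + c * coneDist ι (g • x) x' :=
    fun x x' g => add_nonneg (Nat.cast_nonneg _) (mul_nonneg hc.le (coneDist_nonneg _ _ _))
  have hbdd : ∀ x x' : InfiniteCone Y,
      BddBelow (range fun g : Γ => (ℓ g : ℝ) + c * coneDist ι (g • x) x') := fun x x' =>
    ⟨0, by rintro _ ⟨g, rfl⟩; exact hnn x x' g⟩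
  have hsymm : ∀ x x' : InfiniteCone Y, ⨅ g : Γ, ((ℓ g : ℝ) + c * coneDist ι (g • x) x') ≤
      ⨅ g : Γ, ((ℓ g : ℝ) + c * coneDist ι (g • x') x) := fun x x' => by
    refine le_ciInf fun g => (ciInf_le (hbdd x x') g⁻¹).trans_eq ?_
    rw [hℓ.inv, ← coneDist_smul hι g (g⁻¹ • x) x', smul_inv_smul, coneDist_comm]
  let δ : PseudoMetric (InfiniteCone Y) ℝ :=
    { toFun := fun x x' => ⨅ g : Γ, ((ℓ g : ℝ) + c * coneDist ι (g • x) x')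
      refl' := fun x => le_antisymm
        ((ciInf_le (hbdd x x) 1).trans_eq (by simp [hℓ.one, coneDist_self]))
        (le_ciInf fun g => hnn x x g)
      symm' := fun x x' => le_antisymm (hsymm x x') (hsymm x' x)
      triangle' := fun x y z => by
        refine le_of_forall_pos_le_add fun ε hε => ?_
        obtain ⟨g, hg⟩ := exists_lt_of_ciInf_lt (lt_add_of_pos_right
          (⨅ g : Γ, ((ℓ g : ℝ) + c * coneDist ι (g • x) y)) (half_pos hε))
        obtain ⟨h, hh⟩ := exists_lt_of_ciInf_lt (lt_add_of_pos_right
          (⨅ g : Γ, ((ℓ g : ℝ) + c * coneDist ι (g • y) z)) (half_pos hε))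
        have h1 : coneDist ι ((h * g) • x) z ≤ coneDist ι (g • x) y + coneDist ι (h • y) z := by
          refine (coneDist_triangle ι _ (h • y) _).trans_eq ?_
          rw [mul_smul, coneDist_smul hι]
        have h2 : (ℓ (h * g) : ℝ) ≤ ℓ h + ℓ g := by exact_mod_cast hℓ.mul h g
        have h3 := ciInf_le (hbdd x z) (h * g)
        have h4 := mul_le_mul_of_nonneg_left h1 hc.le
        linarith }
  have hδ : δ ∈ warpingPseudoMetrics (X := InfiniteCone Y) S := by
    refine ⟨fun x x' => (ciInf_le (hbdd x x') 1).trans ?_, fun s hs x =>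
      (ciInf_le (hbdd x (s • x)) s).trans ?_⟩
    · simpa [hℓ.one] using hcle x x'
    · simpa [coneDist_self] using hℓ.gen s hs
  refine ⟨c, C, hc, hC, fun x x' ρ h => ?_, fun g x x' => ?_, fun M => ?_⟩
  · exact exists_lt_of_ciInf_lt (((isGreatest_warpedMetric S).2 hδ x x').trans_lt h)
  · refine ((warpedMetric S).triangle x (g • x) x').trans ?_
    exact add_le_add (warpedMetric_smul_le hℓ g x) ((warpedMetric_le_dist _ _).trans (hleC _ _))
  · have hg : ∀ g : Γ, g ≠ 1 → ∃ R : ℝ, ∀ x : InfiniteCone Y, R ≤ x.radius →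
        M < c * coneDist ι (g • x) x := fun g hg => by
      rcases isEmpty_or_nonempty Y with hY | hY
      · exact ⟨0, fun x => hY.elim x.point⟩
      have hcont : Continuous fun y => ‖ι (g • y) - ι y‖ :=
        ((hK.continuous.comp (continuous_const_smul g)).sub hK.continuous).norm
      obtain ⟨y₀, -, hy₀⟩ := isCompact_univ.exists_isMinOn univ_nonempty hcont.continuousOn
      have hpos : 0 < ‖ι (g • y₀) - ι y₀‖ := norm_pos_iff.2 (sub_ne_zero.2 fun h =>
        hg (hfree g y₀ (hK'.injective h)))
      refine ⟨(|M| + 1) / (c * ‖ι (g • y₀) - ι y₀‖), fun x hx => ?_⟩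
      rw [div_le_iff₀ (by positivity)] at hx
      have h1 : ‖ι (g • y₀) - ι y₀‖ ≤ ‖ι (g • x.point) - ι x.point‖ := hy₀ (mem_univ _)
      have h2 : x.radius * ‖ι (g • x.point) - ι x.point‖ = coneDist ι (g • x) x := by
        change _ = ‖x.radius • ι (g • x.point) - x.radius • ι x.point‖ + |x.radius - x.radius|
        rw [← smul_sub, norm_smul, Real.norm_of_nonneg x.radius_pos.le, sub_self, abs_zero, add_zero]
      rw [← h2]
      have h3 : c * (x.radius * ‖ι (g • y₀) - ι y₀‖) ≤
          c * (x.radius * ‖ι (g • x.point) - ι x.point‖) :=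
        mul_le_mul_of_nonneg_left (mul_le_mul_of_nonneg_left h1 x.radius_pos.le) hc.le
      have h4 : M ≤ |M| := le_abs_self M
      linarith
    have hg' : ∀ g : Γ, ∃ R : ℝ, g ≠ 1 → ∀ x : InfiniteCone Y, R ≤ x.radius →
        M < c * coneDist ι (g • x) x := fun g => by
      by_cases h : g = 1
      · exact ⟨0, fun h' => absurd h h'⟩
      · obtain ⟨R, hR⟩ := hg g h
        exact ⟨R, fun _ => hR⟩
    choose R hR using hg'
    obtain ⟨R₀, hR₀⟩ := ((hℓ.finite ⌊M⌋₊).image R).bddAbove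
    refine ⟨R₀, fun x hx g hgM hcM => ?_⟩
    by_contra hne
    refine absurd hcM (not_le.2 (hR g hne x ((hR₀ ⟨g, ?_, rfl⟩).trans hx)))
    exact Nat.le_floor hgM

/-! ### Fibred coarse embeddings from isometric actions -/

theorem isBounded_setOf_radius_lt {Γ : Type u} {Y : Type v} [Group Γ] [MulAction Γ Y]
    [MetricSpace Y] [CompactSpace Y] (S : Set Γ) (R : ℝ) :
    Bornology.IsBounded {x : WarpedCone S Y | InfiniteCone.radius x < R} := by
  have hD : (0 : ℝ) ≤ Metric.diam (univ : Set Y) := Metric.diam_nonneg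
  refine Metric.isBounded_iff.2 ⟨R * Metric.diam (univ : Set Y) + R * Metric.diam (univ : Set Y),
    fun x hx x' hx' => ?_⟩
  refine (warpedMetric_le_dist (S := S) (Y := Y) x x').trans ?_
  change |InfiniteCone.radius x - InfiniteCone.radius x'| * Metric.diam (univ : Set Y) +
    min (InfiniteCone.radius x) (InfiniteCone.radius x') *
      dist (InfiniteCone.point x) (InfiniteCone.point x') ≤ _
  have hx0 := InfiniteCone.radius_pos x
  have hx0' := InfiniteCone.radius_pos x'
  have hxR : InfiniteCone.radius x < R := hx
  have hxR' : InfiniteCone.radius x' < R := hx'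
  refine add_le_add (mul_le_mul_of_nonneg_right ?_ hD) (mul_le_mul ?_ ?_ dist_nonneg ?_)
  · rw [abs_le]; constructor <;> linarith
  · exact (min_le_left _ _).trans hxR.le
  · exact Metric.dist_le_diam_of_mem isCompact_univ.isBounded (mem_univ _) (mem_univ _)
  · linarith

/-- A generalised inverse of `M`, which need not be monotone: `ρ d` is the infimum of those `e`
beyond which `M` stays at least `d`. The hypothesis `N ≤ M N` makes such `e` exist. -/
theorem exists_lower_control {M : ℕ → ℝ} (hM : ∀ N : ℕ, (N : ℝ) ≤ M N) :
    ∃ ρ : ℝ≥0 → ℝ≥0, Monotone ρ ∧ ¬ BddAbove (range ρ) ∧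
      ∀ d e : ℝ≥0, (∀ N : ℕ, e ≤ N → d ≤ M N) → ρ d ≤ e := by
  have hne : ∀ d : ℝ≥0, {e : ℝ≥0 | ∀ N : ℕ, e ≤ N → (d : ℝ) ≤ M N}.Nonempty := fun d =>
    ⟨d, fun N hN => le_trans (by exact_mod_cast hN) (hM N)⟩
  refine ⟨fun d => sInf {e : ℝ≥0 | ∀ N : ℕ, e ≤ N → (d : ℝ) ≤ M N}, fun d d' h => ?_, ?_, ?_⟩
  · refine csInf_le_csInf (OrderBot.bddBelow _) (hne d') fun e he N hN => ?_
    exact le_trans (by exact_mod_cast h) (he N hN)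
  · rintro ⟨B, hB⟩
    obtain ⟨N, hN⟩ := exists_nat_gt B
    obtain ⟨d, hd⟩ := exists_nat_gt (M N)
    have h1 : sInf {e : ℝ≥0 | ∀ N : ℕ, e ≤ N → (((d : ℝ≥0) : ℝ≥0) : ℝ) ≤ M N} ≤ B :=
      hB ⟨(d : ℝ≥0), rfl⟩
    have h2 : (N : ℝ≥0) ≤ sInf {e : ℝ≥0 | ∀ N : ℕ, e ≤ N → (((d : ℝ≥0) : ℝ≥0) : ℝ) ≤ M N} := by
      refine le_csInf (hne _) fun e he => ?_
      by_contra hlt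
      have := he N (not_le.1 hlt).le
      push_cast at this
      exact absurd this (not_le.2 hd)
    exact absurd (h2.trans h1) (not_le.2 hN)
  · exact fun d e he => csInf_le (OrderBot.bddBelow _) he

/-- The field is constant with section `f`, and the trivialisation over the ball around `x` acts on
the fibre at `y` by `A (γ x y)⁻¹`, with `γ x y` moving `x` close to `y`. Distances in a
trivialisation are then distances from `A (γ x y' * (γ x y)⁻¹) (f y)` to `f y'`. The lower bound
holds for any choice of `γ`; the upper bound and the constancy of the transition maps need the
uniqueness of `γ` far from the apex. -/
theorem fibredCoarselyEmbeds_of_isometric_action {Γ : Type u} {Y : Type v} {E₀ : Type*} {E : Type w}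
    [Group Γ] [MulAction Γ Y] [MetricSpace Y] [CompactSpace Y]
    [NormedAddCommGroup E₀] [NormedSpace ℝ E₀] [NormedAddCommGroup E] [NormedSpace ℝ E] {S : Set Γ}
    {ℓ : Γ → ℕ} (hℓ : IsWordLength S ℓ) {π : Γ →* (E₀ ≃ₗᵢ[ℝ] E₀)} {ι : Y → E₀}
    (hι : ∀ g y, ι (g • y) = π g (ι y)) {c C : ℝ} (hmodel : IsConeModel S ℓ ι c C)
    (A : Γ →* (E ≃ᵢ E)) (f : InfiniteCone Y → E) {k₁ k₂ : ℝ} (hk₁ : 0 ≤ k₁) (hk₂ : 0 ≤ k₂)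
    (h₁ : ∀ g x x', coneDist ι (g • x) x' ≤ k₁ * dist (A g (f x)) (f x'))
    (h₂ : ∀ g x x', dist (A g (f x)) (f x') ≤ k₂ * (coneDist ι (g • x) x' + ℓ g))
    (h₃ : ∀ R : ℝ, ∃ M : ℝ, ∀ g x x', dist (A g (f x)) (f x') ≤ R → (ℓ g : ℝ) ≤ M) :
    FibredCoarselyEmbeds (WarpedCone S Y) E := by
  classical
  have hc := hmodel.pos
  have hC := hmodel.nonneg
  choose M hM using h₃
  obtain ⟨ρm, hmono, hunb, hρm⟩ := exists_lower_control
    (M := fun N : ℕ => |M N| + C * (k₁ * N) + N) (fun N => by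
      have : 0 ≤ |M N| + C * (k₁ * N) := by positivity
      linarith)
  -- The added `1` keeps `L` positive, so that the upper control function is unbounded even when `k₂
  -- = 0`.
  let L : ℝ≥0 := ⟨k₂ * (c⁻¹ + 1) + 1, by positivity⟩
  have hL : 0 < L := by
    have : (0 : ℝ) < k₂ * (c⁻¹ + 1) + 1 := by positivity
    exact this
  refine ⟨fun _ => E, fun _ => inferInstance, fun _ => inferInstance,
    fun _ => ⟨LinearIsometryEquiv.refl ℝ E⟩, fun _ x => f x, ρm, fun s => L * (s + 1), hmono, hunb,
    fun a b h => mul_le_mul_right (add_le_add_left h 1) L, ?_, fun n => ?_⟩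
  · rintro ⟨B, hB⟩
    have h1 : L * (B / L + 1) ≤ B := hB ⟨B / L, rfl⟩
    rw [mul_add, mul_div_cancel₀ _ hL.ne', mul_one] at h1
    exact absurd h1 (not_le.2 (lt_add_of_pos_right _ hL))
  -- Each `γ x y` costs less than `n + 1`, and a near-optimal element between two points of the ball
  -- less than `2 * n + 1`. The products compared below, made of at most four such pieces, therefore
  -- cost at most `4 * n + 4`.
  obtain ⟨R, hR⟩ := hmodel.separated (4 * n + 4)
  have hγ : ∀ x x' : InfiniteCone Y, ∃ g : Γ, warpedMetric S x x' ≤ n →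
      ℓ g + c * coneDist ι (g • x) x' < n + 1 := fun x x' => by
    by_cases h : warpedMetric S x x' ≤ n
    · obtain ⟨g, hg⟩ := hmodel.exists_lt x x' (n + 1) (h.trans_lt (lt_add_one _))
      exact ⟨g, fun _ => hg⟩
    · exact ⟨1, fun h' => absurd h' h⟩
  choose γ hγ using hγ
  have hnn : ∀ x x' : InfiniteCone Y, 0 ≤ c * coneDist ι x x' := fun x x' =>
    mul_nonneg hc.le (coneDist_nonneg _ _ _)
  have hℓ0 : ∀ g : Γ, (0 : ℝ) ≤ ℓ g := fun g => Nat.cast_nonneg _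
  have hℓmul : ∀ g h : Γ, (ℓ (g * h) : ℝ) ≤ ℓ g + ℓ h := fun g h => by exact_mod_cast hℓ.mul g h
  have hℓinv : ∀ g : Γ, (ℓ g⁻¹ : ℝ) = ℓ g := fun g => by rw [hℓ.inv]
  -- far away, group elements moving a point to nearby points coincide
  have huniq : ∀ (x : InfiniteCone Y), R ≤ x.radius → ∀ g h : Γ, (ℓ (h⁻¹ * g) : ℝ) ≤ 4 * n + 4 →
      c * coneDist ι (g • x) (h • x) ≤ 4 * n + 4 → g = h := by
    intro x hx g h h1 h2
    have : h⁻¹ * g = 1 := hR x hx _ h1 (by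
      rwa [← coneDist_smul hι h, ← mul_smul, mul_inv_cancel_left])
    exact (inv_mul_eq_one.1 this).symm
  have hclose : ∀ x y y' : InfiniteCone Y, R ≤ x.radius → warpedMetric S x y ≤ n →
      warpedMetric S x y' ≤ n →
      ℓ (γ x y' * (γ x y)⁻¹) + c * coneDist ι ((γ x y' * (γ x y)⁻¹) • y) y' <
        warpedMetric S y y' + 1 := by
    intro x y y' hxR hy hy'
    have hxy := hγ x y hy
    have hxy' := hγ x y' hy'
    have hyy' : warpedMetric S y y' ≤ 2 * n := by
      have := (warpedMetric S).triangle y x y'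
      rw [(warpedMetric S).symm y x] at this
      linarith
    obtain ⟨h, hh⟩ := hmodel.exists_lt y y' (warpedMetric S y y' + 1) (lt_add_one _)
    -- Both elements move `x` close to `y'`, so separation identifies them, and the cost of `γ x y'
    -- * (γ x y)⁻¹` is that of the near-optimal `h`.
    have hha : h * γ x y = γ x y' := by
      refine huniq x hxR _ _ ?_ ?_
      · have h1 := hℓmul (γ x y')⁻¹ (h * γ x y)
        have h2 := hℓmul h (γ x y)
        rw [hℓinv] at h1
        have h3 := hnn (γ x y • x) y
        have h4 := hnn (γ x y' • x) y'
        have h5 := hnn (h • y) y'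
        linarith
      · have h1 := coneDist_triangle ι ((h * γ x y) • x) (h • y) (γ x y' • x)
        have h2 := coneDist_triangle ι (h • y) y' (γ x y' • x)
        rw [mul_smul, coneDist_smul hι] at h1
        rw [coneDist_comm ι y' (γ x y' • x)] at h2
        have h3 := mul_le_mul_of_nonneg_left (h1.trans (add_le_add_right h2 _)) hc.le
        rw [mul_smul]
        have h4 := hℓ0 (γ x y)
        have h5 := hℓ0 (γ x y')
        have h6 := hℓ0 h
        linarith
    rwa [← hha, mul_inv_cancel_right]
  have hdist : ∀ x y y' : InfiniteCone Y, dist (A (γ x y)⁻¹ (f y)) (A (γ x y')⁻¹ (f y')) =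
      dist (A (γ x y' * (γ x y)⁻¹) (f y)) (f y') := fun x y y' => by
    rw [← (A (γ x y')).dist_eq, ← IsometryEquiv.mul_apply, ← IsometryEquiv.mul_apply, ← map_mul,
      ← map_mul, mul_inv_cancel, map_one]
    rfl
  have hlower : ∀ x y y' : InfiniteCone Y, ∀ N : ℕ,
      dist (A (γ x y)⁻¹ (f y)) (A (γ x y')⁻¹ (f y')) ≤ N →
      warpedMetric S y y' ≤ |M N| + C * (k₁ * N) + N := by
    intro x y y' N hN
    rw [hdist] at hN
    have e1 := hM N _ y y' hN
    have e2 := (h₁ _ y y').trans (mul_le_mul_of_nonneg_left hN hk₁)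
    have e3 := hmodel.le (γ x y' * (γ x y)⁻¹) y y'
    have e4 := mul_le_mul_of_nonneg_left e2 hC
    have e5 := le_abs_self (M N)
    have e6 : (0 : ℝ) ≤ N := Nat.cast_nonneg N
    linarith
  have hupper : ∀ x y y' : InfiniteCone Y, R ≤ x.radius → warpedMetric S x y ≤ n →
      warpedMetric S x y' ≤ n → dist (A (γ x y)⁻¹ (f y)) (A (γ x y')⁻¹ (f y')) ≤
        (k₂ * (c⁻¹ + 1) + 1) * (warpedMetric S y y' + 1) := by
    intro x y y' hxR hy hy'
    have hh := hclose x y y' hxR hy hy'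
    rw [hdist]
    set h := γ x y' * (γ x y)⁻¹
    refine (h₂ h y y').trans ?_
    have e1 : (ℓ h : ℝ) ≤ warpedMetric S y y' + 1 := by linarith [hnn (h • y) y']
    have e2 : coneDist ι (h • y) y' ≤ c⁻¹ * (warpedMetric S y y' + 1) := by
      rw [inv_mul_eq_div, le_div_iff₀ hc, mul_comm]; linarith [hℓ0 h]
    have e3 : k₂ * (coneDist ι (h • y) y' + ℓ h) ≤
        k₂ * (c⁻¹ * (warpedMetric S y y' + 1) + (warpedMetric S y y' + 1)) :=
      mul_le_mul_of_nonneg_left (add_le_add e2 e1) hk₂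
    have e4 := hℓ0 h
    linarith
  have hreturn : ∀ x x' y : InfiniteCone Y, warpedMetric S x y ≤ n → warpedMetric S x' y ≤ n →
      c * coneDist ι (((γ x y)⁻¹ * γ x' y) • x') x < 2 * n + 2 ∧
      (ℓ ((γ x y)⁻¹ * γ x' y) : ℝ) < 2 * n + 2 := by
    intro x x' y h1 h2
    have g1 := hγ x y h1
    have g2 := hγ x' y h2
    constructor
    · rw [← coneDist_smul hι (γ x y), ← mul_smul, mul_inv_cancel_left]
      have h3 := coneDist_triangle ι (γ x' y • x') y (γ x y • x)
      rw [coneDist_comm ι y] at h3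
      have h4 := mul_le_mul_of_nonneg_left h3 hc.le
      have h5 := hℓ0 (γ x y)
      have h6 := hℓ0 (γ x' y)
      linarith
    · have h3 := hℓmul (γ x y)⁻¹ (γ x' y)
      rw [hℓinv] at h3
      have h4 := hnn (γ x y • x) y
      have h5 := hnn (γ x' y • x') y
      linarith
  -- Both elements move `x'` close to `x`, whatever the intermediate point, so they agree.
  have hconst : ∀ x x' y y₀ : InfiniteCone Y, R ≤ x'.radius → warpedMetric S x y ≤ n →
      warpedMetric S x' y ≤ n → warpedMetric S x y₀ ≤ n → warpedMetric S x' y₀ ≤ n →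
      (γ x y)⁻¹ * γ x' y = (γ x y₀)⁻¹ * γ x' y₀ := by
    intro x x' y y₀ hxR hy hy' hy₀ hy₀'
    obtain ⟨h1, h2⟩ := hreturn x x' y hy hy'
    obtain ⟨h3, h4⟩ := hreturn x x' y₀ hy₀ hy₀'
    refine huniq x' hxR _ _ ?_ ?_
    · have h5 := hℓmul ((γ x y₀)⁻¹ * γ x' y₀)⁻¹ ((γ x y)⁻¹ * γ x' y)
      rw [hℓinv] at h5
      linarith
    · have h5 := coneDist_triangle ι (((γ x y)⁻¹ * γ x' y) • x') x (((γ x y₀)⁻¹ * γ x' y₀) • x')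
      rw [coneDist_comm ι x] at h5
      have h6 := mul_le_mul_of_nonneg_left h5 hc.le
      linarith
  have htrans : ∀ (x x' y y₀ : InfiniteCone Y) (e : E),
      (γ x y)⁻¹ * γ x' y = (γ x y₀)⁻¹ * γ x' y₀ →
      A (γ x y)⁻¹ ((A (γ x' y)⁻¹).symm e) = A ((γ x y₀)⁻¹ * γ x' y₀) e := by
    intro x x' y y₀ e h
    rw [← h, map_mul, map_inv A (γ x' y)]
    rfl
  have hball : ∀ {x y : WarpedCone S Y}, y ∈ Metric.closedBall x n →
      warpedMetric (X := InfiniteCone Y) S x y ≤ n := fun {x y} h => by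
    rw [Metric.mem_closedBall, dist_comm] at h; exact h
  refine ⟨{x | InfiniteCone.radius x < R}, fun x y => A (γ x y)⁻¹,
    isBounded_setOf_radius_lt S R, fun x hx y hy y' hy' => ⟨hρm _ _ fun N hN => ?_, ?_⟩, ?_⟩
  · exact hlower x y y' N (by exact_mod_cast hN)
  · exact hupper x y y' (not_lt.1 hx) (hball hy) (hball hy')
  · rintro x hx x' hx' ⟨y₀, hy₀, hyx⟩
    exact ⟨A ((γ x y₀)⁻¹ * γ x' y₀), fun y hy e => htrans x x' y y₀ e
      (hconst x x' y y₀ (not_lt.1 hx') (hball hy.1) (hball hy.2) (hball hy₀) (hball hyx))⟩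

/-! ### Proper actions from fibred coarse embeddings -/

theorem exists_simpleFunc_dist_le {Y : Type*} [MetricSpace Y] [CompactSpace Y] [Nonempty Y]
    [MeasurableSpace Y] [OpensMeasurableSpace Y] {ε : ℝ} (hε : 0 < ε) :
    ∃ q : SimpleFunc Y Y, ∀ y, dist (q y) y ≤ ε := by
  obtain ⟨t, ht⟩ := isCompact_univ.elim_finite_subcover
    (fun k : ℕ => Metric.ball (TopologicalSpace.denseSeq Y k) ε) (fun _ => Metric.isOpen_ball)
    (fun y _ => by
      obtain ⟨k, hk⟩ := (TopologicalSpace.denseRange_denseSeq Y).exists_dist_lt y hε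
      exact mem_iUnion.2 ⟨k, hk⟩)
  refine ⟨SimpleFunc.nearestPt (TopologicalSpace.denseSeq Y) (t.sup id), fun y => ?_⟩
  obtain ⟨k, hk⟩ := mem_iUnion.1 (ht (mem_univ y))
  obtain ⟨hkt, hky⟩ := mem_iUnion.1 hk
  have h := SimpleFunc.edist_nearestPt_le (TopologicalSpace.denseSeq Y) y
    (Finset.le_sup (f := id) hkt)
  rw [edist_dist, edist_dist] at h
  have h2 := (ENNReal.ofReal_le_ofReal_iff dist_nonneg).1 h
  rw [Metric.mem_ball, dist_comm] at hky
  exact h2.trans hky.le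

/-- Neither the action nor word length changes the radius, so a large radial difference forces a
large warped distance. -/
theorem exists_radius_notMem {Γ : Type u} {Y : Type v} {E : Type*} [Group Γ] [MulAction Γ Y]
    [MetricSpace Y] [CompactSpace Y] [NormedAddCommGroup E] [NormedSpace ℝ E] {S : Set Γ}
    {ℓ : Γ → ℕ} {ι : Y → E} {c C : ℝ} (hmodel : IsConeModel S ℓ ι c C) {K : Set (WarpedCone S Y)}
    (hK : Bornology.IsBounded K) :
    ∃ R : ℝ, ∀ x : WarpedCone S Y, R ≤ InfiniteCone.radius x → x ∉ K := by
  rcases K.eq_empty_or_nonempty with rfl | ⟨x₀, hx₀⟩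
  · exact ⟨0, fun x _ => notMem_empty x⟩
  obtain ⟨D, hD⟩ := Metric.isBounded_iff.1 hK
  refine ⟨InfiniteCone.radius x₀ + (D + 1) / c, fun x hx hxK => ?_⟩
  obtain ⟨g, hg⟩ := hmodel.exists_lt x x₀ (D + 1) ((hD hxK hx₀).trans_lt (lt_add_one _))
  have h1 : InfiniteCone.radius x - InfiniteCone.radius x₀ ≤
      coneDist ι (g • (show InfiniteCone Y from x)) x₀ :=
    (le_abs_self _).trans (le_add_of_nonneg_left (norm_nonneg _))
  have h2 : (D + 1) / c ≤ coneDist ι (g • (show InfiniteCone Y from x)) x₀ := by linarith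
  rw [div_le_iff₀ hmodel.pos, mul_comm] at h2
  have h3 : (0 : ℝ) ≤ ℓ g := Nat.cast_nonneg _
  exact absurd hg (not_lt.2 (h2.trans (le_add_of_nonneg_left h3)))

/-- Far away from the apex of the warped cone, orbit maps are isometric on large balls. -/
theorem length_le_warpedMetric {Γ : Type u} {Y : Type v} {E : Type*} [Group Γ] [MulAction Γ Y]
    [MetricSpace Y] [CompactSpace Y] [NormedAddCommGroup E] [NormedSpace ℝ E] {S : Set Γ}
    {ℓ : Γ → ℕ} (hℓ : IsWordLength S ℓ) {π : Γ →* (E ≃ₗᵢ[ℝ] E)} {ι : Y → E}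
    (hι : ∀ g y, ι (g • y) = π g (ι y)) {c C : ℝ} (hmodel : IsConeModel S ℓ ι c C) (n : ℕ) :
    ∃ R : ℝ, ∀ x : InfiniteCone Y, R ≤ x.radius → ∀ g : Γ, ℓ g ≤ n →
      (ℓ g : ℝ) ≤ warpedMetric S x (g • x) := by
  -- If `h` were a cheaper way from `x` to `g • x`, then `g⁻¹ * h` would have length less than `2 *
  -- n` and nearly fix `x`; separation forces `h = g`, whose cost is no less than `ℓ g`.
  obtain ⟨R, hR⟩ := hmodel.separated (2 * n)
  refine ⟨R, fun x hx g hg => ?_⟩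
  by_contra hlt
  obtain ⟨h, hh⟩ := hmodel.exists_lt x (g • x) _ (not_le.1 hlt)
  have hgn : (ℓ g : ℝ) ≤ n := by exact_mod_cast hg
  have h0 : 0 ≤ c * coneDist ι (h • x) (g • x) := mul_nonneg hmodel.pos.le (coneDist_nonneg _ _ _)
  have hℓh : (0 : ℝ) ≤ ℓ h := Nat.cast_nonneg _
  have hmul : (ℓ (g⁻¹ * h) : ℝ) ≤ ℓ g + ℓ h := by
    rw [← hℓ.inv g]; exact_mod_cast hℓ.mul g⁻¹ h
  have h1 : g⁻¹ * h = 1 := hR x hx _ (by linarith) (by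
    rw [← coneDist_smul hι g, ← mul_smul, mul_inv_cancel_left]; linarith)
  rw [inv_mul_eq_one.1 h1] at hh h0
  linarith

/-- The isometry `T` between fibres, conjugated by translations moving base points to `0`. -/
noncomputable def recenter {E : Type*} [NormedAddCommGroup E] (T : E ≃ᵢ E) (a b : E) : E ≃ᵢ E :=
  ((IsometryEquiv.addRight b).trans T).trans (IsometryEquiv.addRight (-a))

theorem recenter_apply {E : Type*} [NormedAddCommGroup E] (T : E ≃ᵢ E) (a b e : E) :
    recenter T a b e = T (e + b) - a := by
  simp [recenter, sub_eq_add_neg]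

/-- On a level of large radius the transition maps satisfy `T a b ∘ T b d = T a d`, so along an
orbit they form a cocycle. Recentred at the section, this cocycle sends `0` to the difference of two
values of the section in one trivialisation, whose norm the embedding controls by word length.
Discretising `Y` makes it a simple function of `y`, and `propertyPLp_of_cocycles` passes to the
limit in `n`. -/
theorem propertyPLp_of_fibredCoarselyEmbeds {Γ : Type u} {Y : Type v} {E₀ : Type*} [Group Γ]
    [MulAction Γ Y] [MetricSpace Y] [CompactSpace Y] [MeasurableSpace Y] [BorelSpace Y]
    [ContinuousConstSMul Γ Y] [NormedAddCommGroup E₀] [NormedSpace ℝ E₀] {S : Set Γ}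
    {ℓ : Γ → ℕ} (hℓ : IsWordLength S ℓ) {π : Γ →* (E₀ ≃ₗᵢ[ℝ] E₀)} {ι : Y → E₀}
    (hι : ∀ g y, ι (g • y) = π g (ι y)) {c C : ℝ} (hmodel : IsConeModel S ℓ ι c C)
    (μ : Measure Y) [IsProbabilityMeasure μ] [SMulInvariantMeasure Γ Y μ]
    {Ω : Type (max v w)} [MeasurableSpace Ω] (ν : Measure Ω) {p : ℝ≥0∞} [Fact (1 ≤ p)] (hp : p ≠ ∞)
    (hf : FibredCoarselyEmbeds (WarpedCone S Y) (Lp ℝ p ν)) : PropertyPLp.{u, max v w} p Γ := by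
  have : Nonempty Y := nonempty_of_isProbabilityMeasure μ
  have : Countable Γ := by
    have h : (univ : Set Γ) = ⋃ n, {g | ℓ g ≤ n} := by
      ext g; simp only [mem_univ, mem_iUnion, true_iff]; exact ⟨ℓ g, le_refl (ℓ g)⟩
    exact countable_univ_iff.1 (h ▸ countable_iUnion fun n => (hℓ.finite n).countable)
  obtain ⟨F, _, _, _, f, ρm, ρp, hρm, hρm', hρp, -, hf⟩ := hf
  have hn : ∀ n : ℕ, ∃ c : Γ → SimpleFunc Y (Lp ℝ p ν ≃ᵢ Lp ℝ p ν),
      (∀ g h, ℓ g ≤ n → ℓ h ≤ n → ∀ y e, c g y (c h (g⁻¹ • y) e) = c (g * h) y e) ∧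
      ∀ g, ℓ g ≤ n → ∀ y, ρm ((ℓ g - 2 : ℕ) : ℝ≥0) ≤ ‖c g y 0‖ ∧
        ‖c g y 0‖ ≤ ρp ((ℓ g + 2 : ℕ) : ℝ≥0) := by
    intro n
    -- The longest displacement needed is by `g * h`, of length at most `2 * n`; the extra `2` pays
    -- for replacing two points by their discretisations.
    obtain ⟨K, t, hK, ht, ht'⟩ := hf (2 * n + 2)
    obtain ⟨R₁, hR₁⟩ := exists_radius_notMem hmodel hK
    obtain ⟨R₂, hR₂⟩ := length_le_warpedMetric hℓ hι hmodel n
    let r : ℝ := max 1 (max R₁ R₂)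
    have hr : 0 < r := zero_lt_one.trans_le (le_max_left _ _)
    let pt : Y → WarpedCone S Y := fun y => (⟨r, hr, y⟩ : InfiniteCone Y)
    have hptK : ∀ y, pt y ∉ K := fun y =>
      hR₁ _ ((le_max_left R₁ R₂).trans (le_max_right 1 (max R₁ R₂)))
    have hptlo : ∀ g : Γ, ℓ g ≤ n → ∀ y, (ℓ g : ℝ) ≤ dist (pt y) (pt (g • y)) := fun g hg y =>
      hR₂ ⟨r, hr, y⟩ ((le_max_right R₁ R₂).trans (le_max_right 1 (max R₁ R₂))) g hg
    have hptup : ∀ (g : Γ) y, dist (pt y) (pt (g • y)) ≤ ℓ g := fun g y =>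
      warpedMetric_smul_le hℓ g ⟨r, hr, y⟩
    have hptd : ∀ a b : Y, dist (pt a) (pt b) ≤ r * dist a b := fun a b => by
      refine (warpedMetric_le_dist (S := S) (Y := Y) ⟨r, hr, a⟩ ⟨r, hr, b⟩).trans_eq ?_
      rw [InfiniteCone.dist_def]
      simp
    -- A level of radius `r` stretches `Y` by at most `r`, so an error of `r⁻¹` in `Y` costs at most
    -- `1` in the warped cone.
    obtain ⟨q, hq⟩ := exists_simpleFunc_dist_le (Y := Y) (inv_pos.2 hr)
    have hqd : ∀ y, dist (pt (q y)) (pt y) ≤ 1 := fun y => (hptd _ _).trans (by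
      calc r * dist (q y) y ≤ r * r⁻¹ := mul_le_mul_of_nonneg_left (hq y) hr.le
        _ = 1 := mul_inv_cancel₀ hr.ne')
    have hup : ∀ g y, dist (pt (q y)) (pt (q (g⁻¹ • y))) ≤ ℓ g + 2 := fun g y => by
      have h1 := dist_triangle4_right (pt (q y)) (pt (q (g⁻¹ • y))) (pt y) (pt (g⁻¹ • y))
      have h2 := hptup g⁻¹ y
      rw [hℓ.inv] at h2
      linarith [hqd y, hqd (g⁻¹ • y)]
    have hlo : ∀ g, ℓ g ≤ n → ∀ y, (ℓ g : ℝ) ≤ dist (pt (q y)) (pt (q (g⁻¹ • y))) + 2 := by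
      intro g hg y
      have h1 := dist_triangle4 (pt y) (pt (q y)) (pt (q (g⁻¹ • y))) (pt (g⁻¹ • y))
      have h2 := hptlo g⁻¹ (by rwa [hℓ.inv]) y
      rw [hℓ.inv] at h2
      have h3 := hqd y
      rw [dist_comm] at h3
      linarith [hqd (g⁻¹ • y)]
    -- For distant base points `T` is the identity, a value never used.
    have hT : ∀ a b : Y, ∃ T : Lp ℝ p ν ≃ᵢ Lp ℝ p ν, dist (pt b) (pt a) ≤ (2 * n + 2 : ℕ) →
        ∀ y, dist y (pt a) ≤ (2 * n + 2 : ℕ) → dist y (pt b) ≤ (2 * n + 2 : ℕ) →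
        ∀ e, t (pt a) y ((t (pt b) y).symm e) = T e := fun a b => by
      by_cases h : dist (pt b) (pt a) ≤ (2 * n + 2 : ℕ)
      · obtain ⟨T, hT⟩ := ht' (pt a) (hptK a) (pt b) (hptK b)
          ⟨pt b, h, Metric.mem_closedBall_self (Nat.cast_nonneg _)⟩
        exact ⟨T, fun _ y h1 h2 => hT y ⟨h1, h2⟩⟩
      · exact ⟨IsometryEquiv.refl _, fun h' => absurd h' h⟩
    choose T hT using hT
    let φ : Y → Lp ℝ p ν := fun a => t (pt a) (pt a) (f (2 * n + 2) (pt a))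
    have hTmul : ∀ a b d, dist (pt a) (pt b) ≤ (2 * n + 2 : ℕ) →
        dist (pt b) (pt d) ≤ (2 * n + 2 : ℕ) → dist (pt a) (pt d) ≤ (2 * n + 2 : ℕ) → ∀ e,
        T a b (T b d e) = T a d e := by
      intro a b d hab hbd had e
      have hba := hab
      have hdb := hbd
      have hda := had
      rw [dist_comm] at hba hdb hda
      have hbb : dist (pt b) (pt b) ≤ (2 * n + 2 : ℕ) := by rw [dist_self]; positivity
      rw [← hT a b hba (pt b) hba hbb, ← hT b d hdb (pt b) hbb hbd, ← hT a d hda (pt b) hba hbd,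
        IsometryEquiv.symm_apply_apply]
    have hTφ : ∀ a b, dist (pt a) (pt b) ≤ (2 * n + 2 : ℕ) →
        ‖T a b (φ b) - φ a‖ = dist (t (pt a) (pt a) (f (2 * n + 2) (pt a)))
          (t (pt a) (pt b) (f (2 * n + 2) (pt b))) := by
      intro a b hab
      have hba := hab
      rw [dist_comm] at hba
      have hbb : dist (pt b) (pt b) ≤ (2 * n + 2 : ℕ) := by rw [dist_self]; positivity
      rw [← hT a b hba (pt b) hba hbb, IsometryEquiv.symm_apply_apply, dist_comm, dist_eq_norm]
    have hle : ∀ {m : ℕ} {d : ℝ}, m ≤ 2 * n → d ≤ m + 2 → d ≤ (2 * n + 2 : ℕ) :=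
      fun {m d} h h' => h'.trans (by exact_mod_cast Nat.add_le_add_right h 2)
    refine ⟨fun g => (q.pair (q.comp (fun y => g⁻¹ • y) (measurable_const_smul g⁻¹))).map
      fun z => recenter (T z.1 z.2) (φ z.1) (φ z.2), fun g h hg hh y e => ?_, fun g hg y => ?_⟩
    · change recenter (T (q y) (q (g⁻¹ • y))) (φ (q y)) (φ (q (g⁻¹ • y)))
        (recenter (T (q (g⁻¹ • y)) (q (h⁻¹ • g⁻¹ • y))) (φ (q (g⁻¹ • y)))
          (φ (q (h⁻¹ • g⁻¹ • y))) e) =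
          recenter (T (q y) (q ((g * h)⁻¹ • y))) (φ (q y)) (φ (q ((g * h)⁻¹ • y))) e
      simp only [recenter_apply, sub_add_cancel]
      have h1 := hle (by omega) (hup g y)
      have h2 := hle (by omega) (hup h (g⁻¹ • y))
      have h3 := hle (by have := hℓ.mul g h; omega) (hup (g * h) y)
      rw [mul_inv_rev, mul_smul] at h3 ⊢
      rw [hTmul _ _ _ h1 h2 h3]
    · have e : ‖recenter (T (q y) (q (g⁻¹ • y))) (φ (q y)) (φ (q (g⁻¹ • y))) 0‖ =
          dist (t (pt (q y)) (pt (q y)) (f (2 * n + 2) (pt (q y))))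
            (t (pt (q y)) (pt (q (g⁻¹ • y))) (f (2 * n + 2) (pt (q (g⁻¹ • y))))) := by
        rw [recenter_apply, zero_add, hTφ _ _ (hle (by omega) (hup g y))]
      have h1 := hle (by omega) (hup g y)
      obtain ⟨h2, h3⟩ := ht (pt (q y)) (hptK _) (pt (q y))
        (Metric.mem_closedBall_self (Nat.cast_nonneg _)) (pt (q (g⁻¹ • y)))
        (by rw [Metric.mem_closedBall, dist_comm]; exact h1)
      change _ ≤ ‖recenter (T (q y) (q (g⁻¹ • y))) (φ (q y)) (φ (q (g⁻¹ • y))) 0‖ ∧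
        ‖recenter (T (q y) (q (g⁻¹ • y))) (φ (q y)) (φ (q (g⁻¹ • y))) 0‖ ≤ _
      rw [e, ← coe_nndist]
      constructor
      -- Natural subtraction truncates: for `ℓ g ≤ 2` the lower bound is only `ρm 0`.
      · refine NNReal.coe_le_coe.2 ((hρm ?_).trans h2)
        rw [← NNReal.coe_le_coe, coe_nndist, NNReal.coe_natCast]
        have := hlo g hg y
        rcases le_total 2 (ℓ g) with h | h
        · rw [Nat.cast_sub h]; push_cast; linarith
        · rw [Nat.sub_eq_zero_of_le h, Nat.cast_zero]; exact dist_nonneg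
      · refine NNReal.coe_le_coe.2 (h3.trans (hρp ?_))
        rw [← NNReal.coe_le_coe, coe_nndist, NNReal.coe_natCast]
        exact_mod_cast hup g y
  choose cc hcc hccb using hn
  refine propertyPLp_of_cocycles.{u, v, w} μ ν hp cc (fun g h => ?_)
    (lo := fun g => ρm ((ℓ g - 2 : ℕ) : ℝ≥0)) (up := fun g => ρp ((ℓ g + 2 : ℕ) : ℝ≥0))
    (fun g => NNReal.coe_nonneg _) (fun R => ?_) (fun g => ?_)
  · filter_upwards [eventually_ge_atTop (ℓ g), eventually_ge_atTop (ℓ h)] with n h1 h2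
    exact hcc n g h h1 h2
  · obtain ⟨_, ⟨s, rfl⟩, hs⟩ := not_bddAbove_iff.1 hρm' R.toNNReal
    obtain ⟨N, hN⟩ := exists_nat_gt s
    refine (hℓ.finite (N + 2)).subset fun g hg => ?_
    by_contra hlt
    have h1 : N + 2 < ℓ g := not_le.1 hlt
    have h2 : (N : ℝ≥0) ≤ ((ℓ g - 2 : ℕ) : ℝ≥0) := by
      exact_mod_cast (by omega : N ≤ ℓ g - 2)
    have h3 : ρm s ≤ R.toNNReal := by
      refine (hρm (hN.le.trans h2)).trans ?_
      exact NNReal.le_toNNReal_of_coe_le hg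
    exact absurd hs (not_lt.2 h3)
  · filter_upwards [eventually_ge_atTop (ℓ g)] with n h1
    exact hccb n g h1

/-! ### Sums of `L^p`-spaces and Hilbert spaces as `L^2`-spaces -/

/-- The disjoint union of two measures. -/
noncomputable def sumMeasure {Ω₁ Ω₂ : Type*} [MeasurableSpace Ω₁] [MeasurableSpace Ω₂]
    (μ : Measure Ω₁) (ν : Measure Ω₂) : Measure (Ω₁ ⊕ Ω₂) :=
  μ.map Sum.inl + ν.map Sum.inr

section sumMeasure

variable {Ω₁ Ω₂ : Type*} [MeasurableSpace Ω₁] [MeasurableSpace Ω₂] {μ : Measure Ω₁}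
  {ν : Measure Ω₂} {p : ℝ≥0∞}

theorem measurableEmbedding_inl : MeasurableEmbedding (Sum.inl : Ω₁ → Ω₁ ⊕ Ω₂) :=
  ⟨Sum.inl_injective, measurable_inl, fun _ h => h.inl_image⟩

theorem measurableEmbedding_inr : MeasurableEmbedding (Sum.inr : Ω₂ → Ω₁ ⊕ Ω₂) :=
  ⟨Sum.inr_injective, measurable_inr, fun _ h => h.inr_image⟩

theorem MemLp.comp_inl {f : Ω₁ ⊕ Ω₂ → ℝ} (hf : MemLp f p (sumMeasure μ ν)) :
    MemLp (f ∘ Sum.inl) p μ :=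
  (hf.mono_measure (Measure.le_add_right le_rfl)).comp_of_map measurable_inl.aemeasurable

theorem MemLp.comp_inr {f : Ω₁ ⊕ Ω₂ → ℝ} (hf : MemLp f p (sumMeasure μ ν)) :
    MemLp (f ∘ Sum.inr) p ν :=
  (hf.mono_measure (Measure.le_add_left le_rfl)).comp_of_map measurable_inr.aemeasurable

theorem ae_sumMeasure_iff {P : Ω₁ ⊕ Ω₂ → Prop} :
    (∀ᵐ ω ∂sumMeasure μ ν, P ω) ↔ (∀ᵐ ω ∂μ, P (Sum.inl ω)) ∧ ∀ᵐ ω ∂ν, P (Sum.inr ω) := by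
  rw [sumMeasure, ae_add_measure_iff, measurableEmbedding_inl.ae_map_iff,
    measurableEmbedding_inr.ae_map_iff]

/-- The restrictions of an `L^p`-function on a disjoint union to the two parts. -/
noncomputable def sumRestrict [Fact (1 ≤ p)] (μ : Measure Ω₁) (ν : Measure Ω₂) :
    Lp ℝ p (sumMeasure μ ν) →ₗ[ℝ] WithLp p (Lp ℝ p μ × Lp ℝ p ν) where
  toFun f := WithLp.toLp p
    ((MemLp.comp_inl (Lp.memLp f)).toLp _, (MemLp.comp_inr (Lp.memLp f)).toLp _)
  map_add' f g := by
    have h := ae_sumMeasure_iff.1 (Lp.coeFn_add f g)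
    rw [← WithLp.toLp_add, Prod.mk_add_mk, ← MemLp.toLp_add, ← MemLp.toLp_add]
    congr 2
    · exact (MemLp.toLp_eq_toLp_iff _ _).2 h.1
    · exact (MemLp.toLp_eq_toLp_iff _ _).2 h.2
  map_smul' c f := by
    have h := ae_sumMeasure_iff.1 (Lp.coeFn_smul c f)
    rw [RingHom.id_apply, ← WithLp.toLp_smul, Prod.smul_mk, ← MemLp.toLp_const_smul,
      ← MemLp.toLp_const_smul]
    congr 2
    · exact (MemLp.toLp_eq_toLp_iff _ _).2 h.1
    · exact (MemLp.toLp_eq_toLp_iff _ _).2 h.2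

theorem norm_sumRestrict [hp1 : Fact (1 ≤ p)] (hp : p ≠ ∞) (f : Lp ℝ p (sumMeasure μ ν)) :
    ‖sumRestrict μ ν f‖ = ‖f‖ := by
  have hr := toReal_pos_of_one_le hp
  rw [WithLp.prod_norm_eq_add hr, one_div, Real.rpow_inv_eq (by positivity) (norm_nonneg _) hr.ne',
    Lp_norm_rpow hp f]
  have hI : Integrable (fun ω => |f ω| ^ p.toReal) (μ.map Sum.inl + ν.map Sum.inr) :=
    (Lp.memLp f).integrable_norm_rpow (zero_lt_one.trans_le hp1.out).ne' hp
  change _ = ∫ ω, |f ω| ^ p.toReal ∂(μ.map Sum.inl + ν.map Sum.inr)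
  rw [integral_add_measure hI.left_of_add_measure hI.right_of_add_measure,
    measurableEmbedding_inl.integral_map, measurableEmbedding_inr.integral_map]
  exact congrArg₂ (· + ·)
    (Lp_norm_rpow_of_ae hp _ (MemLp.comp_inl (Lp.memLp f)).coeFn_toLp)
    (Lp_norm_rpow_of_ae hp _ (MemLp.comp_inr (Lp.memLp f)).coeFn_toLp)

theorem sumRestrict_surjective [hp1 : Fact (1 ≤ p)] (hp : p ≠ ∞) :
    Function.Surjective (sumRestrict (p := p) μ ν) := by
  intro x
  have h0 := (zero_lt_one.trans_le hp1.out).ne'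
  obtain ⟨a, ha⟩ : ∃ a, a = x.fst := ⟨_, rfl⟩
  obtain ⟨b, hb⟩ : ∃ b, b = x.snd := ⟨_, rfl⟩
  have hu : Measurable (Sum.elim a b) :=
    Measurable.sumElim (Lp.stronglyMeasurable a).measurable (Lp.stronglyMeasurable b).measurable
  have hmem : MemLp (Sum.elim a b) p (sumMeasure μ ν) := by
    rw [← integrable_norm_rpow_iff hu.aestronglyMeasurable h0 hp, sumMeasure,
      integrable_add_measure, measurableEmbedding_inl.integrable_map_iff,
      measurableEmbedding_inr.integrable_map_iff]
    exact ⟨(Lp.memLp a).integrable_norm_rpow h0 hp, (Lp.memLp b).integrable_norm_rpow h0 hp⟩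
  have h := ae_sumMeasure_iff.1 hmem.coeFn_toLp
  refine ⟨hmem.toLp _, (WithLp.ofLp_injective p) (Prod.ext ?_ ?_)⟩
  · refine (Lp.ext ?_).trans ha
    exact (MemLp.comp_inl (Lp.memLp (hmem.toLp _))).coeFn_toLp.trans h.1
  · refine (Lp.ext ?_).trans hb
    exact (MemLp.comp_inr (Lp.memLp (hmem.toLp _))).coeFn_toLp.trans h.2

/-- The `L^p`-sum of two `L^p`-spaces is an `L^p`-space. -/
noncomputable def sumLpEquiv [Fact (1 ≤ p)] (hp : p ≠ ∞) (μ : Measure Ω₁) (ν : Measure Ω₂) :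
    WithLp p (Lp ℝ p μ × Lp ℝ p ν) ≃ₗᵢ[ℝ] Lp ℝ p (sumMeasure μ ν) :=
  (LinearIsometryEquiv.ofSurjective ⟨sumRestrict μ ν, norm_sumRestrict hp⟩
    (sumRestrict_surjective hp)).symm

end sumMeasure

/-- A Hilbert basis indexed by `s` identifies `H` with `L^2` of counting measure on `s`. There
almost everywhere equality is equality, so a function orthogonal to all indicators of points
vanishes. -/
theorem exists_linearIsometryEquiv_Lp_two (H : Type w) [NormedAddCommGroup H]
    [InnerProductSpace ℝ H] [CompleteSpace H] :
    ∃ (Ω : Type w) (_ : MeasurableSpace Ω) (μ : Measure Ω), Nonempty (H ≃ₗᵢ[ℝ] Lp ℝ 2 μ) := by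
  obtain ⟨s, b, -⟩ := exists_hilbertBasis ℝ H
  let _ : MeasurableSpace s := ⊤
  have hfin : ∀ i : s, Measure.count ({i} : Set s) ≠ ∞ := fun i => by simp
  let e : s → Lp ℝ 2 (Measure.count : Measure s) := fun i =>
    indicatorConstLp 2 (measurableSet_singleton i) (hfin i) 1
  have he : ∀ i (f : Lp ℝ 2 (Measure.count : Measure s)), inner ℝ (e i) f = f i := fun i f => by
    rw [L2.inner_indicatorConstLp_one, integral_singleton]
    simp
  have hae : ∀ {f g : s → ℝ}, f =ᵐ[Measure.count] g → f = g := fun h => by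
    rwa [EventuallyEq, Measure.ae_count_iff, ← funext_iff] at h
  have hei : ∀ i, (e i : s → ℝ) = ({i} : Set s).indicator fun _ => 1 := fun i =>
    hae indicatorConstLp_coeFn
  classical
  have ho : Orthonormal ℝ e := by
    rw [orthonormal_iff_ite]
    intro i j
    rw [he, hei, indicator_apply]
    rfl
  have hbot : (Submodule.span ℝ (range e))ᗮ = ⊥ := by
    rw [Submodule.eq_bot_iff]
    intro f hf
    refine Lp.ext ?_
    have hz : (f : s → ℝ) = fun _ => 0 := funext fun i => by
      rw [← he i f]
      exact (Submodule.mem_orthogonal _ _).1 hf _ (Submodule.subset_span (mem_range_self i))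
    filter_upwards [Lp.coeFn_zero ℝ 2 (Measure.count : Measure s)] with i hi
    rw [hi, hz]; rfl
  exact ⟨s, ⊤, Measure.count,
    ⟨b.repr.trans (HilbertBasis.mkOfOrthogonalEqBot ho hbot).repr.symm⟩⟩

/-! ### Transport along linear isometries -/

theorem FibredCoarselyEmbeds.trans_equiv {X : Type v} [PseudoMetricSpace X] {E E' : Type w}
    [NormedAddCommGroup E] [NormedSpace ℝ E] [NormedAddCommGroup E'] [NormedSpace ℝ E']
    (U : E ≃ₗᵢ[ℝ] E') (h : FibredCoarselyEmbeds X E) : FibredCoarselyEmbeds X E' := by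
  obtain ⟨F, i₁, i₂, hF, f, ρm, ρp, h1, h2, h3, h4, h⟩ := h
  refine ⟨F, i₁, i₂, fun x => (hF x).map fun V => V.trans U, f, ρm, ρp, h1, h2, h3, h4,
    fun n => ?_⟩
  obtain ⟨K, t, hK, ht, ht'⟩ := h n
  refine ⟨K, fun x y => (t x y).trans U.toIsometryEquiv, hK, fun x hx y hy y' hy' => ?_,
    fun x hx x' hx' hne => ?_⟩
  · have e : nndist (U (t x y (f n y))) (U (t x y' (f n y'))) =
      nndist (t x y (f n y)) (t x y' (f n y')) := U.isometry.nndist_eq _ _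
    have := ht x hx y hy y' hy'
    rwa [← e] at this
  · obtain ⟨T, hT⟩ := ht' x hx x' hx' hne
    refine ⟨(U.symm.toIsometryEquiv.trans T).trans U.toIsometryEquiv, fun y hy e => ?_⟩
    exact congrArg U (hT y hy (U.symm e))

theorem HasProperAffineAction.trans_equiv {Γ : Type u} [Group Γ] {E E' : Type*}
    [NormedAddCommGroup E] [NormedSpace ℝ E] [NormedAddCommGroup E'] [NormedSpace ℝ E']
    (U : E ≃ₗᵢ[ℝ] E') (h : HasProperAffineAction Γ E) : HasProperAffineAction Γ E' := by
  obtain ⟨α, hα⟩ := h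
  refine ⟨{ toFun := fun g => (U.symm.toAffineIsometryEquiv.trans (α g)).trans
              U.toAffineIsometryEquiv
            map_one' := AffineIsometryEquiv.ext fun x => by simp
            map_mul' := fun g h => AffineIsometryEquiv.ext fun x => by simp }, fun e c R => ?_⟩
  refine (hα (U.symm e) (U.symm c) R).subset fun g hg => ?_
  have hg' : dist (U (α g (U.symm e))) c ≤ R := hg
  rw [← U.apply_symm_apply c, U.dist_map] at hg'
  exact hg'

theorem LinearisableIn.trans_equiv {Γ : Type u} {Y : Type v} [Group Γ] [MulAction Γ Y]
    [PseudoMetricSpace Y] {E E' : Type*}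
    [NormedAddCommGroup E] [NormedSpace ℝ E] [NormedAddCommGroup E'] [NormedSpace ℝ E']
    (U : E ≃ₗᵢ[ℝ] E') (h : LinearisableIn Γ Y E) : LinearisableIn Γ Y E' := by
  obtain ⟨π, ι, hι, ⟨C, hC⟩, ⟨C', hC'⟩⟩ := h
  refine ⟨{ toFun := fun g => (U.symm.trans (π g)).trans U
            map_one' := LinearIsometryEquiv.ext fun x => by simp
            map_mul' := fun g h => LinearIsometryEquiv.ext fun x => by simp },
    fun y => U (ι y), fun g y => ?_, ⟨_, U.lipschitz.comp hC⟩, ⟨_, U.antilipschitz.comp hC'⟩⟩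
  simp [hι]

/-! ### Fibred coarse embeddings from proper actions -/

theorem dist_withLp_le {E₁ E₂ : Type*} [NormedAddCommGroup E₁] [NormedAddCommGroup E₂] {p : ℝ≥0∞}
    [Fact (1 ≤ p)] (a b : WithLp p (E₁ × E₂)) :
    dist a b ≤ dist a.fst b.fst + dist a.snd b.snd := by
  rw [← WithLp.dist_toLp_fst p E₁ E₂, ← WithLp.dist_toLp_snd p E₁ E₂]
  have h : a - b = (WithLp.toLp p (a.fst, (0 : E₂)) - WithLp.toLp p (b.fst, (0 : E₂))) +
      (WithLp.toLp p ((0 : E₁), a.snd) - WithLp.toLp p ((0 : E₁), b.snd)) := by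
    apply WithLp.ofLp_injective p
    ext <;> simp
  rw [dist_eq_norm, dist_eq_norm, dist_eq_norm, h]
  exact norm_add_le _ _

theorem exists_norm_le_length {Γ E : Type*} [Group Γ] [NormedAddCommGroup E] [NormedSpace ℝ E]
    {S : Set Γ} (hS : S.Finite) {ℓ : Γ → ℕ} (hℓ : IsWordLength S ℓ) (α : Γ →* (E ≃ᵃⁱ[ℝ] E)) :
    ∃ L : ℝ, 1 ≤ L ∧ ∀ g, ‖α g 0‖ ≤ L * ℓ g := by
  obtain ⟨B, hB⟩ := (hS.image fun s => ‖α s 0‖).bddAbove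
  refine ⟨max 1 B, le_max_left _ _, fun g => ?_⟩
  have hs : ∀ s ∈ S, ‖α s 0‖ ≤ max 1 B := fun s hs =>
    (hB (mem_image_of_mem _ hs)).trans (le_max_right _ _)
  have hinv : ∀ s, ‖α s⁻¹ 0‖ = ‖α s 0‖ := fun s => by
    rw [← dist_zero_right, ← (α s).dist_map, ← Function.comp_apply (f := α s),
      ← AffineIsometryEquiv.coe_mul, ← map_mul, mul_inv_cancel, map_one,
      AffineIsometryEquiv.coe_one, id, dist_zero_left]
  have hmul : ∀ s g, ‖α (s * g) 0‖ ≤ ‖α s 0‖ + ‖α g 0‖ := fun s g => by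
    have h := dist_triangle (α s (α g 0)) (α s 0) 0
    rw [(α s).dist_map, dist_zero_right, dist_zero_right, dist_zero_right] at h
    rw [map_mul, AffineIsometryEquiv.coe_mul, Function.comp_apply]
    linarith
  refine hℓ.induction (fun g n => ‖α g 0‖ ≤ max 1 B * n) ?_ ?_ ?_ g
  · simp
  · intro g n h
    have : (0 : ℝ) ≤ max 1 B := zero_le_one.trans (le_max_left _ _)
    push_cast; linarith
  · intro s hs' g n h
    have h1 := hs s hs'
    have h2 := hmul s g
    have h3 := hmul s⁻¹ g
    rw [hinv] at h3
    push_cast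
    constructor <;> linarith

/-- Three coordinates record three quantities: the first the angular part of `coneDist ι`, the
second the word length through the orbit of `0` under the proper action, and the third, along the
unit vector `e`, the radius. The constant `2` for `coneDist ι` is the number of its summands, each
bounded by the distance in the sum. -/
theorem fibredCoarselyEmbeds_of_hasProperAffineAction {Γ : Type u} {Y : Type v} {E₀ E₁ E₂ : Type w}
    [Group Γ] [MulAction Γ Y] [MetricSpace Y] [CompactSpace Y]
    [NormedAddCommGroup E₀] [NormedSpace ℝ E₀] [NormedAddCommGroup E₁] [NormedSpace ℝ E₁]
    [NormedAddCommGroup E₂] [NormedSpace ℝ E₂] {S : Set Γ} (hS : S.Finite)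
    {ℓ : Γ → ℕ} (hℓ : IsWordLength S ℓ) {π : Γ →* (E₀ ≃ₗᵢ[ℝ] E₀)} {ι : Y → E₀}
    (hι : ∀ g y, ι (g • y) = π g (ι y)) {c C : ℝ} (hmodel : IsConeModel S ℓ ι c C)
    (hΓ : HasProperAffineAction Γ E₁) {e : E₂} (he : ‖e‖ = 1) (p : ℝ≥0∞) [Fact (1 ≤ p)] :
    FibredCoarselyEmbeds (WarpedCone S Y) (WithLp p (E₀ × WithLp p (E₁ × E₂))) := by
  obtain ⟨α, hα⟩ := hΓ
  obtain ⟨L, hL1, hL⟩ := exists_norm_le_length hS hℓ α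
  let A : Γ →* (WithLp p (E₀ × WithLp p (E₁ × E₂)) ≃ᵢ WithLp p (E₀ × WithLp p (E₁ × E₂))) :=
    { toFun := fun g => IsometryEquiv.withLpProdCongr p (π g).toIsometryEquiv
        (IsometryEquiv.withLpProdCongr p (α g).toIsometryEquiv (IsometryEquiv.refl E₂))
      map_one' := by rw [map_one, map_one]; rfl
      map_mul' := fun g h => by rw [map_mul, map_mul]; rfl }
  let f : InfiniteCone Y → WithLp p (E₀ × WithLp p (E₁ × E₂)) := fun x =>
    WithLp.toLp p (x.radius • ι x.point, WithLp.toLp p (0, x.radius • e))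
  have hd₀ : ∀ g (x x' : InfiniteCone Y), dist (A g (f x)).fst (f x').fst =
      ‖x.radius • ι (g • x.point) - x'.radius • ι x'.point‖ := fun g x x' => by
    rw [hι, ← map_smul, ← dist_eq_norm]; rfl
  have hd₁ : ∀ g (x x' : InfiniteCone Y), dist (A g (f x)).snd.fst (f x').snd.fst = ‖α g 0‖ :=
    fun g x x' => dist_zero_right _
  have hd₂ : ∀ g (x x' : InfiniteCone Y), dist (A g (f x)).snd.snd (f x').snd.snd =
      |x.radius - x'.radius| := fun g x x' => by
    rw [← Real.norm_eq_abs, ← mul_one ‖x.radius - x'.radius‖, ← he, ← norm_smul, sub_smul,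
      ← dist_eq_norm]
    rfl
  have hcd : ∀ g (x x' : InfiniteCone Y), coneDist ι (g • x) x' =
      dist (A g (f x)).fst (f x').fst + dist (A g (f x)).snd.snd (f x').snd.snd :=
    fun g x x' => by rw [hd₀, hd₂]; rfl
  refine fibredCoarselyEmbeds_of_isometric_action hℓ hι hmodel A f (k₁ := 2) (k₂ := L)
    zero_le_two (zero_le_one.trans hL1) (fun g x x' => ?_) (fun g x x' => ?_) fun R => ?_
  · rw [hcd]
    have h1 := WithLp.dist_fst_le (A g (f x)) (f x')
    have h2 := WithLp.dist_snd_le (A g (f x)) (f x')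
    have h3 := WithLp.dist_snd_le (A g (f x)).snd (f x').snd
    linarith
  · have h1 := dist_withLp_le (A g (f x)) (f x')
    have h2 := dist_withLp_le (A g (f x)).snd (f x').snd
    have h3 := hcd g x x'
    have h4 := hL g
    have h5 : coneDist ι (g • x) x' ≤ L * coneDist ι (g • x) x' :=
      le_mul_of_one_le_left (coneDist_nonneg _ _ _) hL1
    rw [hd₁] at h2
    linarith
  · obtain ⟨M, hM⟩ := ((hα 0 0 R).image fun g => (ℓ g : ℝ)).bddAbove
    refine ⟨M, fun g x x' h => hM (mem_image_of_mem _ ?_)⟩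
    have h1 := (WithLp.dist_fst_le (A g (f x)).snd (f x').snd).trans
      ((WithLp.dist_snd_le (A g (f x)) (f x')).trans h)
    rw [hd₁] at h1
    simpa using h1

theorem fibredCoarselyEmbedsInLp_of_propertyPLp {Γ : Type u} {Y : Type v} [Group Γ]
    [MulAction Γ Y] [MetricSpace Y] [CompactSpace Y] {p : ℝ≥0∞} [hp1 : Fact (1 ≤ p)] (hp : p ≠ ∞)
    {Ω : Type w} [MeasurableSpace Ω] {μ : Measure Ω} {S : Set Γ} (hS : S.Finite)
    {ℓ : Γ → ℕ} (hℓ : IsWordLength S ℓ) {π : Γ →* (Lp ℝ p μ ≃ₗᵢ[ℝ] Lp ℝ p μ)} {ι : Y → Lp ℝ p μ}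
    (hι : ∀ g y, ι (g • y) = π g (ι y)) {c C : ℝ} (hmodel : IsConeModel S ℓ ι c C)
    (hΓ : PropertyPLp.{u, w} p Γ) : FibredCoarselyEmbedsInLp.{v, w} p (WarpedCone S Y) := by
  obtain ⟨Ω₁, _, ν, hν⟩ := hΓ
  -- The line recording the radius is the `L^p`-space of a point, so the whole target is again an
  -- `L^p`-space.
  let δ : Measure PUnit.{w + 1} := Measure.dirac PUnit.unit
  have he : ‖Lp.const p δ (1 : ℝ)‖ = 1 := by
    have : IsProbabilityMeasure δ := Measure.dirac.isProbabilityMeasure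
    rw [Lp.norm_const p δ 1 (zero_lt_one.trans_le hp1.out).ne']
    simp
  refine ⟨_, _, sumMeasure μ (sumMeasure ν δ), ?_⟩
  exact (fibredCoarselyEmbeds_of_hasProperAffineAction hS hℓ hι hmodel hν he p).trans_equiv
    ((LinearIsometryEquiv.withLpProdCongr p (LinearIsometryEquiv.refl ℝ _)
      (sumLpEquiv hp ν δ)).trans (sumLpEquiv hp μ (sumMeasure ν δ)))

/-! ### The equivalence -/

/-- The whole space may be taken as the exceptional set, leaving nothing to check. -/
theorem fibredCoarselyEmbeds_of_isBounded {X : Type v} [PseudoMetricSpace X]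
    (hX : Bornology.IsBounded (univ : Set X)) (E : Type w) [NormedAddCommGroup E]
    [NormedSpace ℝ E] : FibredCoarselyEmbeds X E := by
  have h : ¬ BddAbove (range (id : ℝ≥0 → ℝ≥0)) := by
    rw [range_id]; exact not_bddAbove_univ
  exact ⟨fun _ => E, fun _ => inferInstance, fun _ => inferInstance,
    fun _ => ⟨LinearIsometryEquiv.refl ℝ E⟩, fun _ _ => 0, id, id, monotone_id, h, monotone_id, h,
    fun _ => ⟨univ, fun _ _ => IsometryEquiv.refl E, hX, fun x hx => absurd (mem_univ x) hx,
      fun x hx => absurd (mem_univ x) hx⟩⟩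

theorem isBounded_univ_warpedCone {Γ : Type u} {Y : Type v} [Group Γ] [MulAction Γ Y]
    [MetricSpace Y] [CompactSpace Y] [Subsingleton Y] (S : Set Γ) :
    Bornology.IsBounded (univ : Set (WarpedCone S Y)) := by
  have h : ∀ x y : InfiniteCone Y, dist x y = 0 := fun x y => by
    rw [InfiniteCone.dist_def, Metric.diam_subsingleton subsingleton_univ,
      Subsingleton.elim y.point x.point]
    simp
  exact Metric.isBounded_iff.2 ⟨0, fun x _ y _ =>
    (warpedMetric_le_dist (S := S) (Y := Y) x y).trans_eq (h x y)⟩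

theorem hasProperAffineAction_of_finite (Γ : Type u) [Group Γ] [Finite Γ] (E : Type w)
    [NormedAddCommGroup E] [NormedSpace ℝ E] : HasProperAffineAction Γ E :=
  ⟨1, fun _ _ _ => toFinite _⟩

theorem fibredCoarselyEmbedsInLp_iff_propertyPLp {Γ : Type u} [Group Γ] {S : Set Γ} (hS : S.Finite)
    (hgen : Subgroup.closure S = ⊤) {Y : Type v} [MetricSpace Y] [CompactSpace Y]
    [MeasurableSpace Y] [BorelSpace Y] [MulAction Γ Y] [ContinuousConstSMul Γ Y]
    (hfree : ∀ (g : Γ) (y : Y), g • y = y → g = 1) (μ : Measure Y) [IsProbabilityMeasure μ]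
    [SMulInvariantMeasure Γ Y μ] {p : ℝ≥0∞} [Fact (1 ≤ p)] (hp : p ≠ ∞)
    (hlin : LinearisableInLp.{u, v, max v w} p Γ Y) :
    FibredCoarselyEmbedsInLp.{v, max v w} p (WarpedCone S Y) ↔ PropertyPLp.{u, max v w} p Γ := by
  obtain ⟨Ω, _, ν, π, ι, hι, ⟨C, hC⟩, ⟨C', hC'⟩⟩ := hlin
  -- If the diameter vanishes, `Y` is a point, freeness makes Γ trivial and the warped cone has
  -- diameter zero, so both sides hold.
  rcases Metric.diam_nonneg.eq_or_lt' (a := Metric.diam (univ : Set Y)) with hd | hd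
  · have hY : Nonempty Y := nonempty_of_isProbabilityMeasure μ
    have : Subsingleton Y := ⟨fun a b => dist_le_zero.1 (hd ▸ Metric.dist_le_diam_of_mem
      isCompact_univ.isBounded (mem_univ a) (mem_univ b))⟩
    have : Subsingleton Γ := ⟨fun g h => by
      obtain ⟨y⟩ := hY
      rw [hfree g y (Subsingleton.elim _ _), hfree h y (Subsingleton.elim _ _)]⟩
    exact ⟨fun _ => ⟨Ω, _, ν, hasProperAffineAction_of_finite Γ _⟩, fun _ => ⟨Ω, _, ν,
      fibredCoarselyEmbeds_of_isBounded (isBounded_univ_warpedCone S) _⟩⟩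
  · obtain ⟨ℓ, hℓ⟩ := exists_isWordLength hS hgen
    obtain ⟨c, c', hmodel⟩ := exists_isConeModel hℓ hfree hd hι hC hC'
    refine ⟨fun ⟨Ω', _, ν', h⟩ => ?_, fun h => ?_⟩
    · exact propertyPLp_of_fibredCoarselyEmbeds.{u, v, w} hℓ hι hmodel μ ν' hp h
    · exact fibredCoarselyEmbedsInLp_of_propertyPLp hp hS hℓ hι hmodel h

theorem fibredCoarselyEmbedsInHilbert_iff {X : Type v} [PseudoMetricSpace X] :
    FibredCoarselyEmbedsInHilbert.{v, w} X ↔ FibredCoarselyEmbedsInLp.{v, w} 2 X := by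
  constructor
  · rintro ⟨H, _, _, _, h⟩
    obtain ⟨Ω, _, ν, ⟨U⟩⟩ := exists_linearIsometryEquiv_Lp_two H
    exact ⟨Ω, _, ν, h.trans_equiv U⟩
  · rintro ⟨Ω, _, ν, h⟩
    exact ⟨Lp ℝ 2 ν, inferInstance, inferInstance, inferInstance, h⟩

theorem aTMenable_iff {Γ : Type u} [Group Γ] : ATMenable.{u, w} Γ ↔ PropertyPLp.{u, w} 2 Γ := by
  constructor
  · rintro ⟨H, _, _, _, h⟩
    obtain ⟨Ω, _, ν, ⟨U⟩⟩ := exists_linearIsometryEquiv_Lp_two H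
    exact ⟨Ω, _, ν, h.trans_equiv U⟩
  · rintro ⟨Ω, _, ν, h⟩
    exact ⟨Lp ℝ 2 ν, inferInstance, inferInstance, inferInstance, h⟩

theorem LinearisableInHilbert.linearisableInLp {Γ : Type u} {Y : Type v} [Group Γ] [MulAction Γ Y]
    [PseudoMetricSpace Y] (h : LinearisableInHilbert.{u, v, w} Γ Y) :
    LinearisableInLp.{u, v, w} 2 Γ Y := by
  obtain ⟨H, _, _, _, h⟩ := h
  obtain ⟨Ω, _, ν, ⟨U⟩⟩ := exists_linearIsometryEquiv_Lp_two H
  exact ⟨Ω, _, ν, h.trans_equiv U⟩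

end WarpedCones

theorem mainTheorem7 {Γ : Type u} [Group Γ] (S : Set Γ) (hS : S.Finite)
    (hgen : Subgroup.closure S = ⊤)
    {Y : Type v} [MetricSpace Y] [CompactSpace Y] [MeasurableSpace Y] [BorelSpace Y]
    [MulAction Γ Y] [ContinuousConstSMul Γ Y]
    (hfree : ∀ (g : Γ) (y : Y), g • y = y → g = 1)
    (hinv : ∃ μ : Measure Y, IsProbabilityMeasure μ ∧ SMulInvariantMeasure Γ Y μ) :
    (WarpedCones.LinearisableInHilbert.{u, v, max v w} Γ Y →
      (WarpedCones.FibredCoarselyEmbedsInHilbert.{v, max v w} (WarpedCones.WarpedCone S Y) ↔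
        WarpedCones.ATMenable.{u, max v w} Γ)) ∧
    ∀ (p : ℝ≥0∞) [Fact (1 ≤ p)], p ≠ ∞ →
      WarpedCones.LinearisableInLp.{u, v, max v w} p Γ Y →
        (WarpedCones.FibredCoarselyEmbedsInLp.{v, max v w} p (WarpedCones.WarpedCone S Y) ↔
          WarpedCones.PropertyPLp.{u, max v w} p Γ) := by
  obtain ⟨μ, _, _⟩ := hinv
  refine ⟨fun h => ?_, fun p _ hp h => ?_⟩
  · rw [WarpedCones.fibredCoarselyEmbedsInHilbert_iff, WarpedCones.aTMenable_iff]
    exact WarpedCones.fibredCoarselyEmbedsInLp_iff_propertyPLp.{u, v, w} hS hgen hfree μ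
      ENNReal.ofNat_ne_top h.linearisableInLp
  · exact WarpedCones.fibredCoarselyEmbedsInLp_iff_propertyPLp.{u, v, w} hS hgen hfree μ hp h
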